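/- Let $(N_r)_{r\ge 1}$ be a sequence of odd integers with $N_r>1$ for all $r$, $N_r\to\infty$ and $\sum_r 1/N_r^2=\infty$. Let $\mathfrak S$ be the set of all real sequences $i=(i^{(r)})_{r\ge1}$ with $1\le i^{(r)}<N_r$ for all $r$ and $i^{(r)}/N_r\to 0$ as $r\to\infty$. For $i,j\in\mathfrak S$ write $i\prec j$ if $i^{(r)}>j^{(r)}$ for all $r$ and $i^{(r)}/j^{(r)}\to\infty$ as $r\to\infty$. Put $d_0=1$, $d_r=1/(N_1N_2\cdots N_r)$ and $C_r=d_{r-1}\left(\left(\tfrac12,\tfrac12\right)+\mathbb Z^2\right)\subseteq\mathbb R^2$ for $r\ge1$. For $i\in\mathfrak S$ let $$W_i=\mathbb R^2\setminus\bigcup_{r=1}^\infty\ \bigcup_{c\in C_r}B_\infty\left(c,\tfrac12 i^{(r)}d_r\right),$$ where $B_\infty(c,\rho)$ is the open ball of radius $\rho$ around $c$ in the maximum norm, that is, the open axis-parallel square with centre $c$ and side $2\rho$. Let $n\ge2$, let $\|\cdot\|$ be the Euclidean norm on $\mathbb R^n$, and put $M_i=W_i\times\mathbb R^{n-2}\subseteq\mathbb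 R^n$ for $i\in\mathfrak S$ and $$M=\bigcup_{i\in\mathfrak S,\ i\prec(1,1,1,\dots)}M_i .$$ (1) If $k,l\in\mathfrak S$ with $k\prec l$, $y\in M_k$ and $d>0$, then for every Lipschitz function $g\colon\mathbb R^n\to\mathbb R$ there is a point $x\in M_l$ with $\|x-y\|\le d$ at which $g$ is Fréchet differentiable. (2) Consequently, for every Lipschitz function $g\colon\mathbb R^n\to\mathbb R$, the set of points of $M$ at which $g$ is Fréchet differentiable is dense in $M$. -/

import Mathlib

open Filter Topology

noncomputable section

namespace NullSet

/-- The index set `𝔖` attached to a sequence `N`: the real sequences `i` with `1 ≤ i r < N r`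
for all `r` and `i r / N r → 0`.
All sequences are indexed by `r = 0, 1, 2, …` instead of `r = 1, 2, 3, …`: the value at `r` here
is the term of index `r + 1` when counting from one. -/
def Index (N : ℕ → ℕ) : Set (ℕ → ℝ) :=
  {i | (∀ r, 1 ≤ i r ∧ i r < (N r : ℝ)) ∧ Tendsto (fun r => i r / (N r : ℝ)) atTop (𝓝 0)}

/-- `i ≺ j`: `i r > j r` for all `r`, and `i r / j r → ∞`. -/
def Prec (i j : ℕ → ℝ) : Prop :=
  (∀ r, i r > j r) ∧ Tendsto (fun r => i r / j r) atTop atTop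

/-- The side length `1 / (N 0 * ⋯ * N (r - 1))`, the inverse of the product of the first `r` terms
of `N`; in particular `side N 0 = 1`. -/
def side (N : ℕ → ℕ) (r : ℕ) : ℝ :=
  1 / ∏ s ∈ Finset.range r, (N s : ℝ)

/-- The lattice `side N r • ((1/2, 1/2) + ℤ²)` in the plane: the centres of the squares removed
at step `r` (step `r + 1` when counting from one). -/
def lattice (N : ℕ → ℕ) (r : ℕ) : Set (ℝ × ℝ) :=
  {c | ∃ a b : ℤ, c = (side N r * (1 / 2 + (a : ℝ)), side N r * (1 / 2 + (b : ℝ)))}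

/-- The planar set `W_i`: the complement of the union of all open squares with centre
`c ∈ lattice N r` and side `i r * side N (r + 1)`. The distance of `ℝ × ℝ` is the sup distance,
so that `Metric.ball` is an open square. -/
def planeSet (N : ℕ → ℕ) (i : ℕ → ℝ) : Set (ℝ × ℝ) :=
  (⋃ r : ℕ, ⋃ c ∈ lattice N r, Metric.ball c (1 / 2 * i r * side N (r + 1)))ᶜ

/-- `M_i = W_i × ℝ^(n-2)`, as a subset of Euclidean space `ℝ^n` (`n ≥ 2`). -/
def spaceSet (N : ℕ → ℕ) {n : ℕ} (hn : 2 ≤ n) (i : ℕ → ℝ) : Set (EuclideanSpace ℝ (Fin n)) :=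
  {x | (x ⟨0, by omega⟩, x ⟨1, by omega⟩) ∈ planeSet N i}

/-- `M`, the union of the sets `M_i` over all `i ∈ 𝔖` with `i ≺ (1, 1, 1, …)`. -/
def unionSet (N : ℕ → ℕ) {n : ℕ} (hn : 2 ≤ n) : Set (EuclideanSpace ℝ (Fin n)) :=
  ⋃ i ∈ {i : ℕ → ℝ | i ∈ Index N ∧ Prec i (fun _ => 1)}, spaceSet N hn i

end NullSet

end

/-!
The set `M_j` is far from being a neighbourhood of its points, but if `i ≺ j` then near a point of
`M_i` it contains, up to an error that is an arbitrarily small fraction of the scale, every wedge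
(union of two segments with a common end point); this is `wedgeApprox_spaceSet`. The proof of
differentiability uses nothing else about these sets, apart from closedness and monotonicity.

Fix a Lipschitz function `f` and join `k` to `l` by the decreasing chain of indices
`interp k l t`, `0 ≤ t ≤ 1`. By the method of Preiss one looks for a point `x` of some `M_t` with
`t < 1` and a unit vector `e` at which the directional derivative of `f` is almost maximal among
all pairs `(x', e')` located nearby in slightly larger sets. The search is an iteration
(`exists_almostMaximal`): at each stage a small multiple of `⟪e, ·⟫` is added to `f`, which makes
directions converge, and a candidate `(x', e')` is only admitted if its increments in the direction
`e` are close to those at `x`, with an error `K √(gain of slope)`. This control makes the limit of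
the slopes a directional derivative at the limit point.

Almost maximality implies differentiability (`hasFDerivAt_of_almostMaximal`). Suppose that
`f (x + h) - f x` differs from `⟪e, h⟫` times the slope by more than `ε ‖h‖`; let `β` be a small
multiple of `ε` and `s = ‖h‖ / β`. The wedge that runs through `x + h` and has its end points on the
line `x + ℝ e`, at distance about `s`, is only by a factor `1 + O(β ^ 2)` longer than the straight
line, whereas the value of `f` at its vertex deviates from the value on the line by a large multiple
of `β ^ 2 s`. So the derivative along the wedge must exceed the slope by a large multiple of `β ^ 2`
somewhere. That a point can be chosen where the increments satisfy the admission condition as well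
is the one-dimensional statement `exists_deriv_ge_and_abs_sub_le`: for a Lipschitz function `u` on
the line, the integral of `u'` over the points where some difference quotient exceeds `K √u'` is
small compared with `∫ |u'|` if `K` is large (`setLIntegral_steepSet_le`), by the weak-type estimate
of Hardy and Littlewood.

The wedges come from arithmetic (`exists_wedge_planeSet`). Along a line in an integer direction
`(a, b)` with `b - a` odd, the function `b x - a y` is constant, and it takes values in
`σ (ℤ + 1/2)` at the centres `σ ((1/2, 1/2) + ℤ²)`; hence such lines through grid points of a level
avoid all squares of the later levels, provided that `a` and `b` are small compared with
`N r / j r`. The squares of the earlier levels are avoided near a point of `W_i`, since those for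
`i` exceed those for `j` by more than the scale considered, and only one critical level needs a
choice among three candidates.

The density of the points of differentiability follows with the index `l = √i`, which satisfies
`i ≺ l ≺ 1`.
-/

namespace NullSet

open MeasureTheory Set

/-! ### A maximal inequality for Lipschitz functions on the line -/

theorem ofReal_abs_sub_le_lintegral_deriv {C : NNReal} {h : ℝ → ℝ} (hh : LipschitzWith C h)
    {a b : ℝ} (hab : a ≤ b) :
    ENNReal.ofReal |h b - h a| ≤ ∫⁻ x in Icc a b, ‖deriv h x‖ₑ := by
  have hac : AbsolutelyContinuousOnInterval h a b :=
    (hh.lipschitzOnWith (s := uIcc a b)).absolutelyContinuousOnInterval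
  rw [← hac.integral_deriv_eq_sub, ← Real.enorm_eq_ofReal_abs,
    intervalIntegral.integral_of_le hab]
  exact (enorm_integral_le_lintegral_enorm _).trans (lintegral_mono_set Ioc_subset_Icc_self)

/-- Weak-type `(1, 1)` estimate for the maximal difference quotient, with the total variation
`∫ |h'|` on the right-hand side. -/
theorem volume_setOf_lt_abs_sub_le {C : NNReal} {h : ℝ → ℝ} (hh : LipschitzWith C h)
    {u : ℝ} (hu : 0 < u) :
    volume {τ : ℝ | ∃ t : ℝ, u * |t| < |h (τ + t) - h τ|} ≤
      ENNReal.ofReal (10 / u) * ∫⁻ x, ‖deriv h x‖ₑ := by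
  set V := ∫⁻ x, ‖deriv h x‖ₑ with hV
  set T := {τ : ℝ | ∃ t : ℝ, u * |t| < |h (τ + t) - h τ|} with hT
  by_cases hVtop : V = ⊤
  · rw [hVtop, ENNReal.mul_top (by simpa using by positivity)]
    exact le_top
  choose! t ht using fun (τ : ℝ) (hτ : τ ∈ T) => hτ
  have hball : ∀ τ ∈ T, ENNReal.ofReal (u * |t τ|) ≤
      ∫⁻ x in Metric.closedBall τ |t τ|, ‖deriv h x‖ₑ := by
    intro τ hτ
    refine (ENNReal.ofReal_le_ofReal (ht τ hτ).le).trans ?_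
    rw [Real.closedBall_eq_Icc]
    rcases le_total 0 (t τ) with h0 | h0
    · refine (ofReal_abs_sub_le_lintegral_deriv hh (by linarith : τ ≤ τ + t τ)).trans
        (lintegral_mono_set (Icc_subset_Icc ?_ ?_))
      · rw [abs_of_nonneg h0]
        linarith
      · rw [abs_of_nonneg h0]
    · rw [abs_sub_comm]
      refine (ofReal_abs_sub_le_lintegral_deriv hh (by linarith : τ + t τ ≤ τ)).trans
        (lintegral_mono_set (Icc_subset_Icc ?_ ?_))
      · rw [abs_of_nonpos h0, sub_neg_eq_add]
      · rw [abs_of_nonpos h0]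
        linarith
  have hbdd : ∀ τ ∈ T, |t τ| ≤ V.toReal / u := by
    intro τ hτ
    rw [le_div_iff₀ hu, mul_comm]
    exact (ENNReal.ofReal_le_iff_le_toReal hVtop).1
      ((hball τ hτ).trans (setLIntegral_le_lintegral _ _))
  obtain ⟨w, hwT, hdisj, hcov⟩ := Vitali.exists_disjoint_subfamily_covering_enlargement_closedBall
    T id (fun τ => |t τ|) _ hbdd 5 (by norm_num)
  simp only [id] at hdisj hcov
  have hpos : ∀ τ ∈ T, 0 < |t τ| := by
    intro τ hτ
    have h1 := ht τ hτ
    rw [abs_pos]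
    intro h0
    simp [h0] at h1
  have hcount : w.Countable := hdisj.countable_of_nonempty_interior fun τ hτ =>
    ⟨τ, Metric.ball_subset_interior_closedBall (Metric.mem_ball_self (hpos τ (hwT hτ)))⟩
  have hsub : T ⊆ ⋃ b ∈ w, Metric.closedBall b (5 * |t b|) := by
    intro τ hτ
    obtain ⟨b, hb, hb'⟩ := hcov τ hτ
    exact mem_iUnion₂.2 ⟨b, hb, hb' (Metric.mem_closedBall_self (abs_nonneg _))⟩
  calc volume T ≤ volume (⋃ b ∈ w, Metric.closedBall b (5 * |t b|)) := measure_mono hsub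
    _ ≤ ∑' b : w, volume (Metric.closedBall (b : ℝ) (5 * |t b|)) := measure_biUnion_le _ hcount _
    _ ≤ ∑' b : w, ENNReal.ofReal (10 / u) *
          ∫⁻ x in Metric.closedBall (b : ℝ) |t b|, ‖deriv h x‖ₑ := by
        refine ENNReal.tsum_le_tsum fun b => ?_
        rw [Real.volume_closedBall]
        refine le_trans (le_of_eq ?_) (mul_le_mul_right (hball b (hwT b.2)) _)
        rw [← ENNReal.ofReal_mul (by positivity)]
        congr 1
        field_simp
        ring
    _ = ENNReal.ofReal (10 / u) *
          ∫⁻ x in ⋃ b ∈ w, Metric.closedBall (b : ℝ) |t b|, ‖deriv h x‖ₑ := by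
        rw [ENNReal.tsum_mul_left, lintegral_biUnion hcount (fun b _ => measurableSet_closedBall)
          hdisj]
    _ ≤ _ := mul_le_mul_right (setLIntegral_le_lintegral _ _) _

/-- The points at which some difference quotient exceeds `K √(h')`. Rational increments suffice by
continuity and make the set visibly measurable. -/
def steepSet (h : ℝ → ℝ) (K : ℝ) : Set ℝ :=
  {τ | ∃ q : ℚ, K * √(deriv h τ) * |(q : ℝ)| < |h (τ + q) - h τ|}

theorem measurableSet_steepSet {h : ℝ → ℝ} (hh : Continuous h) (K : ℝ) :
    MeasurableSet (steepSet h K) := by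
  have : steepSet h K = ⋃ q : ℚ, {τ | K * √(deriv h τ) * |(q : ℝ)| < |h (τ + q) - h τ|} := by
    ext; simp [steepSet]
  rw [this]
  refine MeasurableSet.iUnion fun q => measurableSet_lt ?_ ?_
  · exact (((measurable_deriv h).sqrt).const_mul _).mul_const _
  · exact (by fun_prop : Continuous fun τ : ℝ => |h (τ + q) - h τ|).measurable

theorem abs_sub_le_of_notMem_steepSet {h : ℝ → ℝ} (hh : Continuous h) {K τ : ℝ}
    (hτ : τ ∉ steepSet h K) (t : ℝ) :
    |h (τ + t) - h τ| ≤ K * √(deriv h τ) * |t| := by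
  have hcl : IsClosed {t : ℝ | |h (τ + t) - h τ| ≤ K * √(deriv h τ) * |t|} :=
    isClosed_le (by fun_prop) (by fun_prop)
  have hsub : range ((↑) : ℚ → ℝ) ⊆ {t : ℝ | |h (τ + t) - h τ| ≤ K * √(deriv h τ) * |t|} := by
    rintro _ ⟨q, rfl⟩
    by_contra hq
    exact hτ ⟨q, not_le.1 hq⟩
  have := closure_minimal hsub hcl
  rw [Rat.denseRange_cast.closure_range] at this
  exact this (mem_univ t)

/-- On the steep set `h'` is below the square of the maximal difference quotient over `K ^ 2`;
the weak-type estimate at height `K √y`, integrated over the levels `y` of `h'`, converges because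
`y ↦ y ^ (-1/2)` is integrable at `0`. -/
theorem setLIntegral_steepSet_le {C : NNReal} {h : ℝ → ℝ} (hh : LipschitzWith C h)
    {K : ℝ} (hK : 0 < K) :
    ∫⁻ τ in steepSet h K, ENNReal.ofReal (deriv h τ) ≤
      ENNReal.ofReal (20 * √C / K) * ∫⁻ x, ‖deriv h x‖ₑ := by
  set V := ∫⁻ x, ‖deriv h x‖ₑ with hV
  have hm := measurableSet_steepSet hh.continuous K
  set H : ℝ → ℝ := (steepSet h K).indicator fun τ => max (deriv h τ) 0 with hH
  have hHm : Measurable H := ((measurable_deriv h).max measurable_const).indicator hm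
  have hH0 : 0 ≤ H := fun τ => indicator_nonneg (fun _ _ => le_max_right _ _) τ
  have h1 : ∫⁻ τ in steepSet h K, ENNReal.ofReal (deriv h τ) = ∫⁻ τ, ENNReal.ofReal (H τ) := by
    rw [← lintegral_indicator hm]
    congr 1
    ext τ
    by_cases hτ : τ ∈ steepSet h K <;> simp [hH, hτ, ENNReal.ofReal_max]
  rw [h1, lintegral_eq_lintegral_meas_lt volume (ae_of_all _ hH0) hHm.aemeasurable]
  have hlev : ∀ y ∈ Ioi (0 : ℝ), volume {τ | y < H τ} ≤
      (Ioc (0 : ℝ) C).indicator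
        (fun y => ENNReal.ofReal (10 / K * y ^ (-(1 / 2) : ℝ)) * V) y := by
    intro y hy
    have hy : 0 < y := hy
    have hmem : ∀ τ, y < H τ → τ ∈ steepSet h K ∧ y < deriv h τ := by
      intro τ hτ
      by_cases hs : τ ∈ steepSet h K
      · rw [hH, indicator_of_mem hs, lt_max_iff] at hτ
        exact ⟨hs, hτ.resolve_right (not_lt.2 hy.le)⟩
      · rw [hH, indicator_of_notMem hs] at hτ
        exact absurd hτ (not_lt.2 hy.le)
    by_cases hyC : y ≤ C
    · rw [indicator_of_mem (show y ∈ Ioc (0 : ℝ) C from ⟨hy, hyC⟩)]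
      have hsub : {τ | y < H τ} ⊆ {τ : ℝ | ∃ t : ℝ, (K * √y) * |t| < |h (τ + t) - h τ|} := by
        intro τ hτ
        obtain ⟨⟨q, hq⟩, hd⟩ := hmem τ hτ
        refine ⟨q, lt_of_le_of_lt ?_ hq⟩
        gcongr
      refine (measure_mono hsub).trans
        ((volume_setOf_lt_abs_sub_le hh (by positivity)).trans (le_of_eq ?_))
      congr 2
      rw [Real.sqrt_eq_rpow, Real.rpow_neg hy.le]
      field_simp
    · have hempty : {τ | y < H τ} = ∅ := by
        ext τ
        simp only [Set.mem_ofPred_eq, mem_empty_iff_false, iff_false]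
        intro hτ
        have h2 := (hmem τ hτ).2
        have h3 : ‖deriv h τ‖ ≤ C := norm_deriv_le_of_lipschitz hh
        exact hyC (h2.le.trans ((le_abs_self _).trans h3))
      rw [hempty, measure_empty]
      exact bot_le
  calc ∫⁻ y in Ioi (0 : ℝ), volume {τ | y < H τ}
      ≤ ∫⁻ y in Ioi (0 : ℝ), (Ioc (0 : ℝ) C).indicator
        (fun y => ENNReal.ofReal (10 / K * y ^ (-(1 / 2) : ℝ)) * V) y :=
        setLIntegral_mono' measurableSet_Ioi hlev
    _ ≤ ∫⁻ y in Ioc (0 : ℝ) C, ENNReal.ofReal (10 / K * y ^ (-(1 / 2) : ℝ)) * V := by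
        rw [← lintegral_indicator measurableSet_Ioc]
        exact setLIntegral_le_lintegral _ _
    _ = ENNReal.ofReal (20 * √C / K) * V := by
        rw [lintegral_mul_const _ (by fun_prop)]
        congr 1
        have hint : IntervalIntegrable (fun y : ℝ => 10 / K * y ^ (-(1 / 2) : ℝ)) volume 0 C :=
          (intervalIntegral.intervalIntegrable_rpow' (by norm_num)).const_mul _
        rw [← ofReal_integral_eq_lintegral_ofReal]
        · congr 1
          rw [← intervalIntegral.integral_of_le C.coe_nonneg, intervalIntegral.integral_const_mul,
            integral_rpow (Or.inl (by norm_num)), Real.sqrt_eq_rpow]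
          norm_num
          ring
        · exact (intervalIntegrable_iff_integrableOn_Ioc_of_le C.coe_nonneg).1 hint
        · refine (ae_restrict_iff' measurableSet_Ioc).2 (ae_of_all _ fun y hy => ?_)
          have := hy.1
          positivity

/-- A `3`-Lipschitz function that is constant outside `[-s, s]`, has nearly equal values at `±s` and
deviates from them by `α` at `0` has a point, away from `±s`, where the derivative `g` is at least
`α / (8 s)` and every difference quotient is at most `200 √g`. The reason: `∫ |h'|` is comparable
to `∫ (h')⁺ ≥ 3 α / 4`, whereas the points where `h'` is small, the steep set and the
neighbourhoods of `±s` contribute too little to the latter. -/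
theorem exists_deriv_ge_and_abs_sub_le {h : ℝ → ℝ} (hh : LipschitzWith 3 h) {s α θ : ℝ}
    (hs : 0 < s) (hα : 0 < α) (hθ : 0 ≤ θ) (hθα : 48 * (θ * s) ≤ α)
    (hr : ∀ t, s ≤ t → h t = h s) (hl : ∀ t, t ≤ -s → h t = h (-s))
    (h0 : α ≤ |h 0 - h (-s)|) (h1 : |h s - h (-s)| ≤ α / 4) :
    ∃ τ, |τ| < (1 - θ) * s ∧ τ ≠ 0 ∧ DifferentiableAt ℝ h τ ∧ α / (8 * s) ≤ deriv h τ ∧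
      ∀ t, |h (τ + t) - h τ| ≤ 200 * √(deriv h τ) * |t| := by
  by_contra! hcon
  set D := deriv h with hD
  have hDm : Measurable D := measurable_deriv h
  have hD3 : ∀ τ, |D τ| ≤ 3 := fun τ => norm_deriv_le_of_lipschitz hh
  have hac : ∀ a b, AbsolutelyContinuousOnInterval h a b := fun a b =>
    (hh.lipschitzOnWith (s := uIcc a b)).absolutelyContinuousOnInterval
  have hDi : ∀ a b, IntervalIntegrable D volume a b := fun a b => (hac a b).intervalIntegrable_deriv
  have hPi : ∀ a b, IntervalIntegrable (fun τ => max (D τ) 0) volume a b := fun a b =>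
    ⟨(hDi a b).1.pos_part, (hDi a b).2.pos_part⟩
  set P := ∫ τ in (-s)..s, max (D τ) 0 with hP
  have hss : -s ≤ s := by linarith
  -- the derivative vanishes outside `[-s, s]`
  have hV : ∫⁻ x, ‖D x‖ₑ = ENNReal.ofReal (∫ τ in (-s)..s, |D τ|) := by
    rw [intervalIntegral.integral_of_le hss, ofReal_integral_eq_lintegral_ofReal
      ((hDi _ _).1.abs) (ae_of_all _ fun _ => abs_nonneg _),
      ← lintegral_indicator measurableSet_Ioc]
    refine lintegral_congr_ae ?_
    have hne : ∀ᵐ x : ℝ, x ≠ -s := by simp [ae_iff, measure_singleton]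
    filter_upwards [hne] with x hx
    by_cases hxs : x ∈ Ioc (-s) s
    · rw [indicator_of_mem hxs, Real.enorm_eq_ofReal_abs]
    · rw [indicator_of_notMem hxs]
      have hx0 : D x = 0 := by
        rw [mem_Ioc, not_and_or, not_lt, not_le] at hxs
        rcases hxs with hxs | hxs
        · have hlt : x < -s := lt_of_le_of_ne hxs hx
          have : h =ᶠ[𝓝 x] fun _ => h (-s) := by
            filter_upwards [Iio_mem_nhds hlt] with y hy using hl y (le_of_lt hy)
          rw [hD, this.deriv_eq, deriv_const]
        · have : h =ᶠ[𝓝 x] fun _ => h s := by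
            filter_upwards [Ioi_mem_nhds hxs] with y hy using hr y (le_of_lt hy)
          rw [hD, this.deriv_eq, deriv_const]
      simp [hx0]
  have habs : ∫ τ in (-s)..s, |D τ| = 2 * P - (h s - h (-s)) := by
    rw [← (hac (-s) s).integral_deriv_eq_sub, hP, ← intervalIntegral.integral_const_mul,
      ← intervalIntegral.integral_sub ((hPi _ _).const_mul _) (hDi _ _)]
    congr 1
    ext τ
    rcases le_total 0 (D τ) with h' | h'
    · rw [abs_of_nonneg h', max_eq_left h']; simp only [hD]; ring
    · rw [abs_of_nonpos h', max_eq_right h']; simp only [hD]; ring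
  have hPle : ∀ a b, -s ≤ a → a ≤ b → b ≤ s → h b - h a ≤ P := by
    intro a b ha hab hb
    rw [← (hac a b).integral_deriv_eq_sub]
    refine (intervalIntegral.integral_mono_on hab (hDi _ _) (hPi _ _)
      (fun τ _ => le_max_left (D τ) 0)).trans ?_
    exact intervalIntegral.integral_mono_interval ha hab hb
      (ae_of_all _ fun τ => le_max_right (D τ) 0) (hPi _ _)
  have hPα : 3 / 4 * α ≤ P := by
    have e1 := hPle (-s) 0 le_rfl (by linarith) hs.le
    have e2 := hPle 0 s (by linarith) hs.le le_rfl
    rcases abs_cases (h 0 - h (-s)) with h' | h' <;> rcases abs_cases (h s - h (-s)) with h'' | h''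
      <;> linarith
  -- the three contributions to the integral of the positive part
  set B := steepSet h 200 with hB
  have hBm : MeasurableSet B := measurableSet_steepSet hh.continuous 200
  set E := Ioo (-((1 - θ) * s)) ((1 - θ) * s) with hE
  have hθs : 0 ≤ θ * s := by positivity
  have hEc : volume (Ioc (-s) s \ E) ≤ ENNReal.ofReal (2 * (θ * s)) := by
    have hsub : Ioc (-s) s \ E ⊆ Icc (-s) (-s + θ * s) ∪ Icc (s - θ * s) s := by
      rintro x ⟨⟨hx1, hx2⟩, hx3⟩
      rw [hE, mem_Ioo, not_and_or, not_lt, not_lt] at hx3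
      rcases hx3 with hx3 | hx3
      · exact Or.inl ⟨hx1.le, by linarith⟩
      · exact Or.inr ⟨by linarith, hx2⟩
    refine (measure_mono hsub).trans ((measure_union_le _ _).trans (le_of_eq ?_))
    rw [Real.volume_Icc, Real.volume_Icc, ← ENNReal.ofReal_add (by linarith) (by linarith)]
    congr 1
    ring
  have hae : ∀ᵐ τ : ℝ, τ ∈ Ioc (-s) s → ENNReal.ofReal (D τ) ≤ ENNReal.ofReal (α / (8 * s)) +
      (B.indicator (fun τ => ENNReal.ofReal (D τ)) τ + (Eᶜ).indicator (fun _ => 3) τ) := by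
    have hne : ∀ᵐ x : ℝ, x ≠ 0 := by simp [ae_iff, measure_singleton]
    filter_upwards [hh.ae_differentiableAt_real, hne] with τ hdiff hτ0 _
    by_cases hτB : τ ∈ B
    · rw [indicator_of_mem hτB]
      exact le_add_left (le_add_right le_rfl)
    by_cases hτE : τ ∈ E
    · refine le_add_right (ENNReal.ofReal_le_ofReal ?_)
      by_contra! hlt
      obtain ⟨t, ht⟩ := hcon τ (abs_lt.2 hτE) hτ0 hdiff hlt.le
      exact absurd (abs_sub_le_of_notMem_steepSet hh.continuous hτB t) (not_le.2 ht)
    · rw [indicator_of_mem (show τ ∈ Eᶜ from hτE)]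
      refine le_add_left (le_add_left ?_)
      rw [← ENNReal.ofReal_ofNat]
      exact ENNReal.ofReal_le_ofReal ((le_abs_self _).trans (hD3 τ))
  have hPlin : ENNReal.ofReal P = ∫⁻ τ in Ioc (-s) s, ENNReal.ofReal (D τ) := by
    rw [hP, intervalIntegral.integral_of_le hss, ofReal_integral_eq_lintegral_ofReal
      ((hPi _ _).1) (ae_of_all _ fun _ => le_max_right _ _)]
    simp [ENNReal.ofReal_max]
  have hP0 : 0 ≤ P := by linarith
  have hA0 : 0 ≤ ∫ τ in (-s)..s, |D τ| :=
    intervalIntegral.integral_nonneg hss fun _ _ => abs_nonneg _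
  have hmain : ENNReal.ofReal P ≤ ENNReal.ofReal (α / 4) +
      (ENNReal.ofReal (20 * √3 / 200 * ∫ τ in (-s)..s, |D τ|) +
        ENNReal.ofReal (3 * (2 * (θ * s)))) := by
    rw [hPlin]
    refine (setLIntegral_mono_ae' measurableSet_Ioc hae).trans ?_
    rw [lintegral_add_left measurable_const, lintegral_add_left
      ((hDm.ennreal_ofReal).indicator hBm)]
    gcongr
    · rw [setLIntegral_const, Real.volume_Ioc, ← ENNReal.ofReal_mul (by positivity)]
      refine le_of_eq ?_
      congr 1
      field_simp
      ring
    · refine (setLIntegral_le_lintegral _ _).trans ?_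
      rw [lintegral_indicator hBm, ENNReal.ofReal_mul (by positivity), ← hV]
      exact setLIntegral_steepSet_le hh (by norm_num)
    · rw [lintegral_indicator measurableSet_Ioo.compl, setLIntegral_const,
        Measure.restrict_apply measurableSet_Ioo.compl, ENNReal.ofReal_mul (by norm_num),
        ENNReal.ofReal_ofNat]
      refine mul_le_mul_right ?_ _
      rw [inter_comm, ← sdiff_eq]
      exact hEc
  rw [← ENNReal.ofReal_add (by positivity) (by positivity),
    ← ENNReal.ofReal_add (by positivity) (by positivity),
    ENNReal.ofReal_le_ofReal_iff (by positivity), habs] at hmain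
  -- hence the steep set contributes at most `0.18 ∫ |h'|`
  have hsqrt : √3 ≤ 1.8 := by
    rw [Real.sqrt_le_left (by norm_num)]; norm_num
  have hnn : 0 ≤ 2 * P - (h s - h (-s)) := habs ▸ hA0
  have h2 : 20 * √3 / 200 * (2 * P - (h s - h (-s))) ≤ 0.18 * (2 * P - (h s - h (-s))) := by
    refine mul_le_mul_of_nonneg_right ?_ hnn
    linarith
  have h3 := neg_le_of_abs_le h1
  linarith

end NullSet

noncomputable section

namespace NullSet

open scoped RealInnerProductSpace

/-! ### A point and a direction of almost locally maximal directional derivative -/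

section Search

variable {E : Type*} [NormedAddCommGroup E] [InnerProductSpace ℝ E]

/-- The increments of `f` along `e` from `x'` and from `x` differ by at most `c |t|`. -/
def IncrClose (f : E → ℝ) (e x x' : E) (c : ℝ) : Prop :=
  ∀ t : ℝ, |(f (x' + t • e) - f x') - (f (x + t • e) - f x)| ≤ c * |t|

/-- A point, a direction, and a number meant to be the derivative of a function at the point in that
direction. -/
structure DirPoint (E : Type*) where
  pt : E
  dir : E
  slope : ℝ

/-- `P.dir` is a unit vector along which `f` has derivative `P.slope` at `P.pt`. -/
def DirPoint.Admissible (P : DirPoint E) (f : E → ℝ) : Prop :=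
  ‖P.dir‖ = 1 ∧ HasLineDerivAt ℝ f P.slope P.pt P.dir

/-- The directional derivative after the linear function `⟪v, ·⟫` is added to the function. -/
def DirPoint.val (P : DirPoint E) (v : E) : ℝ := P.slope + ⟪v, P.dir⟫

/-- A stage of the search: the current point, direction and slope, the accumulated linear
perturbation `tilt`, an index `lower` with `pt ∈ M lower`, a strict upper bound `upper` for the
indices allowed later, and the radius of the ball around `pt` to which the search is confined. -/
structure SearchState (E : Type*) extends DirPoint E where
  tilt : E
  lower : ℝ
  upper : ℝ
  radius : ℝ

/-- The perturbation used at the next stage: tilting by `t` in the current direction penalises every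
change of direction. -/
def SearchState.nextTilt (s : SearchState E) (t : ℝ) : E := s.tilt + t • s.dir

/-- The candidates for the next stage: they lie in the ball, have at least the current slope, and
their increments along the current direction differ from the current ones by at most
`(σ + K √(gain of slope)) |t|` for some `σ < c`. The index `i < s.upper` and the number `σ < c` are
strictly smaller so that a candidate leaves room for the stages after it. -/
def candidates (f : E → ℝ) (M : ℝ → Set E) (K t c : ℝ) (s : SearchState E) : Set (DirPoint E) :=
  {Q | Q.Admissible f ∧ (∃ i < s.upper, Q.pt ∈ M i) ∧ ‖Q.pt - s.pt‖ < s.radius ∧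
    s.val (s.nextTilt t) ≤ Q.val (s.nextTilt t) ∧
    ∃ σ < c, IncrClose f s.dir s.pt Q.pt
      (σ + K * √(Q.val (s.nextTilt t) - s.val (s.nextTilt t)))}

/-- The error allowed in the comparison of increments at stage `m`. -/
def incrTol (m : ℕ) : ℝ := (1 / 16) ^ m

/-- The size of the linear perturbation added at stage `m`. -/
def tiltSize (m : ℕ) : ℝ := 1 / 8 * (1 / 2) ^ m

/-- How far from the supremum the slope chosen at stage `m` may be; it is small compared with
`tiltSize m * incrTol m ^ 2`, so that directions change by much less than `incrTol m`. -/
def maxTol (K : ℝ) (m : ℕ) : ℝ := (1 / 512) ^ m / (1024 * (1 + K ^ 2))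

theorem incrTol_pos (m : ℕ) : 0 < incrTol m := by unfold incrTol; positivity

theorem tiltSize_pos (m : ℕ) : 0 < tiltSize m := by unfold tiltSize; positivity

theorem maxTol_pos (K : ℝ) (m : ℕ) : 0 < maxTol K m := by unfold maxTol; positivity

theorem incrTol_succ (m : ℕ) : incrTol (m + 1) = incrTol m / 16 := by
  unfold incrTol; ring

theorem tendsto_incrTol : Tendsto incrTol atTop (𝓝 0) :=
  tendsto_pow_atTop_nhds_zero_of_lt_one (by norm_num) (by norm_num)

theorem maxTol_le_pow (K : ℝ) (m : ℕ) : maxTol K m ≤ (1 / 512) ^ m / 1024 := by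
  unfold maxTol
  gcongr
  nlinarith [sq_nonneg K]

theorem two_mul_maxTol_le (K : ℝ) (m : ℕ) :
    2 * maxTol K m ≤ tiltSize m * (incrTol m / 8) ^ 2 := by
  have h1 := maxTol_le_pow K m
  have h2 : tiltSize m * (incrTol m / 8) ^ 2 = (1 / 512) ^ m / 512 := by
    unfold tiltSize incrTol
    have : ((1 / 512 : ℝ)) ^ m = (1 / 2) ^ m * ((1 / 16) ^ 2) ^ m := by
      rw [← mul_pow]; norm_num
    rw [this, ← pow_mul, mul_comm 2 m, pow_mul]; ring
  rw [h2]; linarith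

theorem maxTol_le_incrTol (K : ℝ) (m : ℕ) : maxTol K m ≤ incrTol m / 8 := by
  refine (maxTol_le_pow K m).trans ?_
  unfold incrTol
  gcongr <;> norm_num

theorem mul_sqrt_maxTol_le {K : ℝ} (m : ℕ) : K * √(maxTol K m) ≤ incrTol m := by
  refine le_of_sq_le_sq ?_ (incrTol_pos m).le
  rw [mul_pow, Real.sq_sqrt (maxTol_pos K m).le]
  unfold maxTol incrTol
  rw [← pow_mul, mul_comm m 2, pow_mul]
  have h1 : ((1 / 512 : ℝ)) ^ m ≤ ((1 / 16) ^ 2) ^ m := by gcongr; norm_num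
  have h2 : K ^ 2 / (1024 * (1 + K ^ 2)) ≤ 1 := by
    rw [div_le_one (by positivity)]; nlinarith [sq_nonneg K]
  calc K ^ 2 * ((1 / 512) ^ m / (1024 * (1 + K ^ 2)))
      = (1 / 512) ^ m * (K ^ 2 / (1024 * (1 + K ^ 2))) := by ring
    _ ≤ ((1 / 16) ^ 2) ^ m * 1 := by gcongr
    _ = _ := mul_one _

theorem HasLineDerivAt.exists_abs_sub_le {f : E → ℝ} {p : ℝ} {x e : E}
    (h : HasLineDerivAt ℝ f p x e) {η : ℝ} (hη : 0 < η) :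
    ∃ τ > 0, ∀ t : ℝ, |t| < τ → |f (x + t • e) - f x - t * p| ≤ η * |t| := by
  have h1 := (hasLineDerivAt_iff_isLittleO_nhds_zero.1 h).def hη
  obtain ⟨τ, hτ, h2⟩ := Metric.eventually_nhds_iff.1 h1
  refine ⟨τ, hτ, fun t ht => ?_⟩
  simpa using h2 (show dist t 0 < τ by simpa using ht)

theorem abs_increment_sub_increment_le {f : E → ℝ} (hf : LipschitzWith 1 f) (x e e' : E) (t : ℝ) :
    |(f (x + t • e) - f x) - (f (x + t • e') - f x)| ≤ ‖e - e'‖ * |t| := by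
  have h := hf.dist_le_mul (x + t • e) (x + t • e')
  rw [Real.dist_eq, dist_eq_norm, NNReal.coe_one, one_mul, add_sub_add_left_eq_sub, ← smul_sub,
    norm_smul, Real.norm_eq_abs, mul_comm] at h
  simpa using h

theorem inner_le_one_of_norm_eq_one {x y : E} (hx : ‖x‖ = 1) (hy : ‖y‖ = 1) : ⟪x, y⟫ ≤ 1 := by
  simpa [hx, hy] using real_inner_le_norm x y

theorem DirPoint.val_add_smul (P : DirPoint E) (v w : E) (t : ℝ) :
    P.val (v + t • w) = P.val v + t * ⟪w, P.dir⟫ := by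
  unfold DirPoint.val
  rw [inner_add_left, real_inner_smul_left]; ring

/-- An invariant of the search: the current slope is within `maxTol K m` of the supremum over the
candidates. -/
structure SearchState.Good (f : E → ℝ) (M : ℝ → Set E) (K : ℝ) (m : ℕ) (s : SearchState E) :
    Prop where
  admissible : s.Admissible f
  pt_mem : s.pt ∈ M s.lower
  lower_lt : s.lower < s.upper
  radius_pos : 0 < s.radius
  norm_tilt : ‖s.tilt‖ ≤ 1 / 4 * (1 - (1 / 2) ^ m)
  le_max : ∀ Q ∈ candidates f M K (tiltSize m) (incrTol m) s,
    Q.val s.tilt ≤ s.val s.tilt + maxTol K m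

section Estimates

variable {f : E → ℝ} {M : ℝ → Set E} {K : ℝ} {m : ℕ} {s : SearchState E}

/-- Near-maximality before the tilt plus monotonicity after it: the penalty for changing the
direction and the gain of slope are together at most `maxTol K m`. -/
theorem SearchState.Good.penalty_add_gain_le (hs : s.Good f M K m) {Q : DirPoint E}
    (hQ : Q ∈ candidates f M K (tiltSize m) (incrTol m) s) :
    tiltSize m * (1 - ⟪s.dir, Q.dir⟫) +
      (Q.val (s.nextTilt (tiltSize m)) - s.val (s.nextTilt (tiltSize m))) ≤ maxTol K m := by
  have h1 := hs.le_max Q hQ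
  have h2 : ⟪s.dir, s.dir⟫ = 1 := by
    rw [real_inner_self_eq_norm_sq, hs.admissible.1]; norm_num
  unfold SearchState.nextTilt
  rw [DirPoint.val_add_smul, DirPoint.val_add_smul, h2]
  linarith

theorem SearchState.Good.gain_le (hs : s.Good f M K m) {Q : DirPoint E}
    (hQ : Q ∈ candidates f M K (tiltSize m) (incrTol m) s) :
    Q.val (s.nextTilt (tiltSize m)) - s.val (s.nextTilt (tiltSize m)) ≤ maxTol K m := by
  have h1 := hs.penalty_add_gain_le hQ
  have h2 := inner_le_one_of_norm_eq_one hs.admissible.1 hQ.1.1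
  nlinarith [tiltSize_pos m]

theorem SearchState.Good.norm_dir_sub_le (hs : s.Good f M K m) {Q : DirPoint E}
    (hQ : Q ∈ candidates f M K (tiltSize m) (incrTol m) s) :
    ‖Q.dir - s.dir‖ ≤ incrTol m / 8 := by
  have h1 := hs.penalty_add_gain_le hQ
  have h0 := hQ.2.2.2.1
  have h2 := two_mul_maxTol_le K m
  have h3 : ‖Q.dir - s.dir‖ ^ 2 = 2 * (1 - ⟪s.dir, Q.dir⟫) := by
    rw [@norm_sub_sq_real, hs.admissible.1, hQ.1.1, real_inner_comm]; ring
  refine le_of_sq_le_sq ?_ (by have := incrTol_pos m; positivity)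
  refine le_of_mul_le_mul_left ?_ (tiltSize_pos m)
  rw [h3]
  linarith

theorem SearchState.Good.norm_nextTilt_le (hs : s.Good f M K m) :
    ‖s.nextTilt (tiltSize m)‖ ≤ 1 / 4 * (1 - (1 / 2) ^ (m + 1)) := by
  refine (norm_add_le _ _).trans ?_
  rw [norm_smul, hs.admissible.1, Real.norm_of_nonneg (tiltSize_pos m).le]
  have := hs.norm_tilt
  unfold tiltSize
  rw [pow_succ]
  linarith

theorem SearchState.Good.abs_slope_sub_le (hs : s.Good f M K m) {Q : DirPoint E}
    (hQ : Q ∈ candidates f M K (tiltSize m) (incrTol m) s) :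
    |Q.slope - s.slope| ≤ incrTol m / 4 := by
  have h1 := hs.gain_le hQ
  have h0 := hQ.2.2.2.1
  have h2 := hs.norm_dir_sub_le hQ
  have h3 := maxTol_le_incrTol K m
  have h4 : ‖s.nextTilt (tiltSize m)‖ ≤ 1 := by
    refine hs.norm_nextTilt_le.trans ?_
    have : (0 : ℝ) ≤ (1 / 2) ^ (m + 1) := by positivity
    linarith
  have h5 : |⟪s.nextTilt (tiltSize m), Q.dir - s.dir⟫| ≤ incrTol m / 8 := by
    refine (abs_real_inner_le_norm _ _).trans ?_
    nlinarith [norm_nonneg (Q.dir - s.dir), norm_nonneg (s.nextTilt (tiltSize m))]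
  rw [inner_sub_right] at h5
  have h6 := abs_le.1 h5
  unfold DirPoint.val at h0 h1
  rw [abs_le]
  constructor <;> linarith

/-- Candidates of a candidate, in a small enough ball, are candidates of the original state. For
short increments this follows from the directional derivatives at the two base points, which
almost agree; for long ones from the smallness of the ball. -/
theorem SearchState.Good.exists_radius (hf : LipschitzWith 1 f) (hK : 0 ≤ K)
    (hs : s.Good f M K m) {Q₁ : DirPoint E}
    (hQ₁ : Q₁ ∈ candidates f M K (tiltSize m) (incrTol m) s) :
    ∃ δ > 0, ∀ Q : DirPoint E, Q.Admissible f → ‖Q.pt - Q₁.pt‖ < δ → ∀ t : ℝ, 0 ≤ t →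
      Q₁.val (s.nextTilt (tiltSize m) + t • Q₁.dir) ≤
        Q.val (s.nextTilt (tiltSize m) + t • Q₁.dir) →
      IncrClose f Q₁.dir Q₁.pt Q.pt (incrTol m / 4 + K *
        √(Q.val (s.nextTilt (tiltSize m) + t • Q₁.dir) -
          Q₁.val (s.nextTilt (tiltSize m) + t • Q₁.dir))) →
      s.val (s.nextTilt (tiltSize m)) ≤ Q.val (s.nextTilt (tiltSize m)) ∧
        ∃ σ < incrTol m, IncrClose f s.dir s.pt Q.pt
          (σ + K * √(Q.val (s.nextTilt (tiltSize m)) - s.val (s.nextTilt (tiltSize m)))) := by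
  obtain ⟨hadm₁, -, -, hval₁, σ₁, hσ₁, hincr₁⟩ := id hQ₁
  set v := s.nextTilt (tiltSize m) with hv
  have hσpos := incrTol_pos m
  obtain ⟨τ₀, hτ₀, hd₀⟩ := HasLineDerivAt.exists_abs_sub_le hs.admissible.2
    (show 0 < incrTol m / 32 by positivity)
  obtain ⟨τ₁, hτ₁, hd₁⟩ := HasLineDerivAt.exists_abs_sub_le hadm₁.2
    (show 0 < incrTol m / 32 by positivity)
  set τ := min τ₀ τ₁ with hτ
  have hτpos : 0 < τ := lt_min hτ₀ hτ₁
  refine ⟨τ * (incrTol m - σ₁) / 4, by have := sub_pos.2 hσ₁; positivity, ?_⟩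
  intro Q hQ hQ₁pt t ht hval hincr
  rw [DirPoint.val_add_smul, DirPoint.val_add_smul, real_inner_self_eq_norm_sq, hadm₁.1]
    at hval hincr
  have hin := inner_le_one_of_norm_eq_one hadm₁.1 hQ.1
  have hpen : t * ⟪Q₁.dir, Q.dir⟫ ≤ t := by nlinarith
  have hA : 0 ≤ Q.val v - Q₁.val v := by linarith
  refine ⟨by linarith, max ((σ₁ + incrTol m) / 2) (15 / 16 * incrTol m), ?_, fun u => ?_⟩
  · exact max_lt (by linarith) (by linarith)
  have hsq₁ : K * √(Q.val v + t * ⟪Q₁.dir, Q.dir⟫ - (Q₁.val v + t * 1 ^ 2)) ≤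
      K * √(Q.val v - s.val v) := by
    refine mul_le_mul_of_nonneg_left (Real.sqrt_le_sqrt ?_) hK
    linarith
  have hsq₂ : K * √(Q₁.val v - s.val v) ≤ K * √(Q.val v - s.val v) := by
    refine mul_le_mul_of_nonneg_left (Real.sqrt_le_sqrt ?_) hK
    linarith
  by_cases hu : |u| < τ
  · have e1 := abs_increment_sub_increment_le hf Q.pt s.dir Q₁.dir u
    have e2 := hincr u
    have e3 := hd₀ u (lt_of_lt_of_le hu (min_le_left _ _))
    have e4 := hd₁ u (lt_of_lt_of_le hu (min_le_right _ _))
    have e5 : |u * Q₁.slope - u * s.slope| ≤ incrTol m / 4 * |u| := by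
      rw [← mul_sub, abs_mul, mul_comm]
      exact mul_le_mul_of_nonneg_right (hs.abs_slope_sub_le hQ₁) (abs_nonneg u)
    have e6 : ‖s.dir - Q₁.dir‖ * |u| ≤ incrTol m / 8 * |u| := by
      rw [norm_sub_rev]
      exact mul_le_mul_of_nonneg_right (hs.norm_dir_sub_le hQ₁) (abs_nonneg u)
    have e7 := mul_le_mul_of_nonneg_right hsq₁ (abs_nonneg u)
    have e8 : 15 / 16 * incrTol m * |u| ≤
        max ((σ₁ + incrTol m) / 2) (15 / 16 * incrTol m) * |u| :=
      mul_le_mul_of_nonneg_right (le_max_right _ _) (abs_nonneg u)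
    have e9 : 0 ≤ incrTol m * |u| := by positivity
    rw [add_mul] at e2 ⊢
    rw [abs_le] at e1 e2 e3 e4 e5 ⊢
    obtain ⟨e1, e1'⟩ := e1
    obtain ⟨e2, e2'⟩ := e2
    obtain ⟨e3, e3'⟩ := e3
    obtain ⟨e4, e4'⟩ := e4
    obtain ⟨e5, e5'⟩ := e5
    generalize K * √(Q.val v + t * ⟪Q₁.dir, Q.dir⟫ - (Q₁.val v + t * 1 ^ 2)) * |u| = G₁ at *
    generalize K * √(Q.val v - s.val v) * |u| = G at *
    generalize max ((σ₁ + incrTol m) / 2) (15 / 16 * incrTol m) * |u| = c at *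
    constructor <;> linarith
  · have e1 := hincr₁ u
    have e2 := hf.dist_le_mul (Q.pt + u • s.dir) (Q₁.pt + u • s.dir)
    have e3 := hf.dist_le_mul Q.pt Q₁.pt
    rw [NNReal.coe_one, one_mul, Real.dist_eq] at e2 e3
    rw [dist_add_right] at e2
    rw [dist_eq_norm] at e2 e3
    have e4 : τ * (incrTol m - σ₁) / 4 ≤ (incrTol m - σ₁) / 4 * |u| := by
      have := mul_le_mul_of_nonneg_left (not_lt.1 hu) (sub_pos.2 hσ₁).le
      linarith
    have e7 := mul_le_mul_of_nonneg_right hsq₂ (abs_nonneg u)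
    have e8 : (σ₁ + incrTol m) / 2 * |u| ≤
        max ((σ₁ + incrTol m) / 2) (15 / 16 * incrTol m) * |u| :=
      mul_le_mul_of_nonneg_right (le_max_left _ _) (abs_nonneg u)
    rw [add_mul] at e1 ⊢
    rw [abs_le] at e1 e2 e3 ⊢
    obtain ⟨e1, e1'⟩ := e1
    obtain ⟨e2, e2'⟩ := e2
    obtain ⟨e3, e3'⟩ := e3
    constructor <;> linarith

/-- One step of the search. -/
structure SearchState.Next (f : E → ℝ) (M : ℝ → Set E) (K : ℝ) (m : ℕ) (s s' : SearchState E) :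
    Prop where
  mem : s'.toDirPoint ∈ candidates f M K (tiltSize m) (incrTol m) s
  tilt_eq : s'.tilt = s.nextTilt (tiltSize m)
  lower_le : s.lower ≤ s'.lower
  upper_lt : s'.upper < s.upper
  radius_le : s'.radius ≤ s.radius / 2
  radius_add_lt : ‖s'.pt - s.pt‖ + s'.radius < s.radius
  subset : candidates f M K (tiltSize (m + 1)) (4 * incrTol (m + 1)) s' ⊆
    candidates f M K (tiltSize m) (incrTol m) s

theorem exists_forall_le_add {α : Type*} {S : Set α} (hS : S.Nonempty) {F : α → ℝ} {C : ℝ}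
    (hF : ∀ a ∈ S, F a ≤ C) {η : ℝ} (hη : 0 < η) : ∃ a ∈ S, ∀ b ∈ S, F b ≤ F a + η := by
  have hbdd : BddAbove (F '' S) := ⟨C, by rintro _ ⟨a, ha, rfl⟩; exact hF a ha⟩
  obtain ⟨_, ⟨a, ha, rfl⟩, hlt⟩ := exists_lt_of_lt_csSup (hS.image F) (sub_lt_self _ hη)
  exact ⟨a, ha, fun b hb => by linarith [le_csSup hbdd ⟨b, hb, rfl⟩]⟩

theorem DirPoint.Admissible.val_le (hf : LipschitzWith 1 f) {P : DirPoint E}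
    (hP : P.Admissible f) (v : E) : P.val v ≤ 1 + ‖v‖ := by
  have h1 := hP.2.le_of_lipschitz hf
  have h2 := real_inner_le_norm v P.dir
  rw [hP.1] at h1 h2
  rw [Real.norm_eq_abs] at h1
  unfold DirPoint.val
  have := le_abs_self P.slope
  simp at h1
  linarith

theorem SearchState.Good.exists_next (hf : LipschitzWith 1 f) (hM : Monotone M) (hK : 0 ≤ K)
    (hs : s.Good f M K m) : ∃ s', s'.Good f M K (m + 1) ∧ s.Next f M K m s' := by
  have hself : s.toDirPoint ∈ candidates f M K (tiltSize m) (incrTol m) s := by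
    refine ⟨hs.admissible, ⟨_, hs.lower_lt, hs.pt_mem⟩, by simpa using hs.radius_pos, le_rfl,
      0, incrTol_pos m, fun t => ?_⟩
    simp
  obtain ⟨Q₁, hQ₁, hmax⟩ := exists_forall_le_add ⟨_, hself⟩
    (F := fun Q => Q.val (s.nextTilt (tiltSize m)))
    (fun Q hQ => hQ.1.val_le hf _) (maxTol_pos K (m + 1))
  obtain ⟨δ, hδ, hsub⟩ := hs.exists_radius hf hK hQ₁
  obtain ⟨i, hi, hQi⟩ := hQ₁.2.1
  obtain ⟨j, hj₁, hj₂⟩ := exists_between (max_lt hs.lower_lt hi)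
  set r := min (min δ (s.radius / 2)) ((s.radius - ‖Q₁.pt - s.pt‖) / 2) with hr
  have hrad := hQ₁.2.2.1
  have hr0 : 0 < r := lt_min (lt_min hδ (by linarith [hs.radius_pos])) (by linarith)
  have hrδ : r ≤ δ := (min_le_left _ _).trans (min_le_left _ _)
  have hr2 : r ≤ s.radius / 2 := (min_le_left _ _).trans (min_le_right _ _)
  have hr3 : r ≤ (s.radius - ‖Q₁.pt - s.pt‖) / 2 := min_le_right _ _
  let s' : SearchState E := ⟨Q₁, s.nextTilt (tiltSize m), max s.lower i, j, r⟩
  have hsubset : candidates f M K (tiltSize (m + 1)) (4 * incrTol (m + 1)) s' ⊆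
      candidates f M K (tiltSize m) (incrTol m) s := by
    rintro Q ⟨hQ, ⟨i', hi', hQi'⟩, hQr, hQv, σ, hσ, hQinc⟩
    have hclose := hsub Q hQ (lt_of_lt_of_le hQr hrδ) (tiltSize (m + 1)) (tiltSize_pos _).le hQv
      (fun t => (hQinc t).trans (mul_le_mul_of_nonneg_right
        (add_le_add_left (by rw [incrTol_succ] at hσ; linarith) _) (abs_nonneg t)))
    refine ⟨hQ, ⟨i', hi'.trans hj₂, hQi'⟩, ?_, hclose⟩
    have h1 : ‖Q.pt - s.pt‖ ≤ ‖Q.pt - Q₁.pt‖ + ‖Q₁.pt - s.pt‖ :=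
      norm_sub_le_norm_sub_add_norm_sub _ _ _
    have h2 : ‖Q.pt - Q₁.pt‖ < r := hQr
    linarith
  refine ⟨s', ⟨hQ₁.1, hM (le_max_right _ _) hQi, hj₁, hr0, hs.norm_nextTilt_le, ?_⟩,
    ⟨hQ₁, rfl, le_max_left _ _, hj₂, hr2, ?_, hsubset⟩⟩
  · intro Q hQ
    refine hmax Q (hsubset ?_)
    obtain ⟨h1, h2, h3, h4, σ, hσ, h5⟩ := hQ
    exact ⟨h1, h2, h3, h4, σ, by linarith [incrTol_pos (m + 1)], h5⟩
  · change ‖Q₁.pt - s.pt‖ + r < s.radius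
    linarith

end Estimates

end Search

end NullSet

end

noncomputable section

namespace NullSet

open scoped RealInnerProductSpace

section Search

variable {E : Type*} [NormedAddCommGroup E] [InnerProductSpace ℝ E]

/-- Iteration of the search step, from a pair of almost maximal slope among those in a ball around
`y`. -/
theorem exists_searchSeq {f : E → ℝ} (hf : LipschitzWith 1 f)
    {M : ℝ → Set E} (hM : Monotone M) {K : ℝ} (hK : 0 ≤ K)
    {a b : ℝ} (hab : a < b) {y : E} {d : ℝ}
    (hstart : ∃ P : DirPoint E, P.Admissible f ∧ P.pt ∈ M a ∧ ‖P.pt - y‖ < d) :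
    ∃ S : ℕ → SearchState E, (∀ m, (S m).Good f M K m) ∧ (∀ m, (S m).Next f M K m (S (m + 1))) ∧
      a ≤ (S 0).lower ∧ (S 0).upper = b ∧ ‖(S 0).pt - y‖ + (S 0).radius ≤ d := by
  obtain ⟨P₀, hP₀, hP₀M, hP₀y⟩ := hstart
  obtain ⟨Q₀, ⟨hQ₀, ⟨i₀, hi₀, hQ₀M⟩, hQ₀y⟩, hQ₀max⟩ := exists_forall_le_add
    (S := {Q : DirPoint E | Q.Admissible f ∧ (∃ i < b, Q.pt ∈ M i) ∧ ‖Q.pt - y‖ < d})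
    ⟨P₀, hP₀, ⟨a, hab, hP₀M⟩, hP₀y⟩ (F := fun Q => Q.val 0) (fun Q hQ => hQ.1.val_le hf 0)
    (maxTol_pos K 0)
  let s₀ : SearchState E := ⟨Q₀, 0, max a i₀, b, d - ‖Q₀.pt - y‖⟩
  have hs₀ : s₀.Good f M K 0 := by
    refine ⟨hQ₀, hM (le_max_right _ _) hQ₀M, max_lt hab hi₀, sub_pos.2 hQ₀y, ?_, ?_⟩
    · simp [s₀]
    · rintro Q ⟨hQ, hQM, hQr, -⟩
      refine hQ₀max Q ⟨hQ, hQM, ?_⟩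
      have h1 : ‖Q.pt - y‖ ≤ ‖Q.pt - Q₀.pt‖ + ‖Q₀.pt - y‖ :=
        norm_sub_le_norm_sub_add_norm_sub _ _ _
      have h2 : ‖Q.pt - Q₀.pt‖ < d - ‖Q₀.pt - y‖ := hQr
      linarith
  choose! nxt hnxt using fun (m : ℕ) (s : SearchState E) (hs : s.Good f M K m) =>
    hs.exists_next hf hM hK
  let S : ℕ → SearchState E := fun m => Nat.rec s₀ nxt m
  have hS : ∀ m, (S m).Good f M K m := by
    intro m
    induction m with
    | zero => exact hs₀
    | succ m ih => exact (hnxt m (S m) ih).1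
  refine ⟨S, hS, fun m => (hnxt m (S m) (hS m)).2, le_max_left _ _, rfl, ?_⟩
  change ‖Q₀.pt - y‖ + (d - ‖Q₀.pt - y‖) ≤ d
  linarith

variable {f : E → ℝ} {M : ℝ → Set E} {K : ℝ} {S : ℕ → SearchState E}

theorem antitone_candidates (hN : ∀ m, (S m).Next f M K m (S (m + 1))) :
    Antitone fun m => candidates f M K (tiltSize m) (incrTol m) (S m) := by
  refine antitone_nat_of_succ_le fun m Q hQ => (hN m).subset ?_
  obtain ⟨h1, h2, h3, h4, σ, hσ, h5⟩ := hQ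
  exact ⟨h1, h2, h3, h4, σ, by linarith [incrTol_pos (m + 1)], h5⟩

theorem mem_candidates_of_lt (hN : ∀ m, (S m).Next f M K m (S (m + 1))) {m k : ℕ} (hmk : m < k) :
    (S k).toDirPoint ∈ candidates f M K (tiltSize m) (incrTol m) (S m) := by
  obtain ⟨k, rfl⟩ := Nat.exists_eq_add_one_of_ne_zero (Nat.ne_zero_of_lt hmk)
  exact antitone_candidates hN (Nat.lt_succ_iff.1 hmk) (hN k).mem

theorem norm_pt_sub_add_radius_le (hN : ∀ m, (S m).Next f M K m (S (m + 1))) {m k : ℕ}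
    (hmk : m ≤ k) : ‖(S k).pt - (S m).pt‖ + (S k).radius ≤ (S m).radius := by
  induction k, hmk using Nat.le_induction with
  | base => simp
  | succ k _ ih =>
    have h1 := (hN k).radius_add_lt
    have h2 := norm_sub_le_norm_sub_add_norm_sub (S (k + 1)).pt (S k).pt (S m).pt
    linarith

/-- Points, directions, slopes and tilts converge at a geometric rate, and the limit point stays in
every ball. -/
theorem exists_limits [CompleteSpace E] (hS : ∀ m, (S m).Good f M K m)
    (hN : ∀ m, (S m).Next f M K m (S (m + 1))) :
    ∃ (P : DirPoint E) (v : E), Tendsto (fun m => (S m).pt) atTop (𝓝 P.pt) ∧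
      Tendsto (fun m => (S m).dir) atTop (𝓝 P.dir) ∧
      Tendsto (fun m => (S m).slope) atTop (𝓝 P.slope) ∧
      Tendsto (fun m => (S m).tilt) atTop (𝓝 v) ∧
      (∀ m, ‖P.pt - (S m).pt‖ < (S m).radius) ∧
      ∀ m, ‖(S m).dir - P.dir‖ ≤ incrTol m * (2 / 15) := by
  have hrad : ∀ m, (S m).radius ≤ (S 0).radius * (1 / 2) ^ m := by
    intro m
    induction m with
    | zero => simp
    | succ m ih =>
      refine (hN m).radius_le.trans ?_
      rw [pow_succ]
      linarith
  have hx : ∀ m, dist (S m).pt (S (m + 1)).pt ≤ (S 0).radius * (1 / 2) ^ m := by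
    intro m
    have h1 := (hN m).radius_add_lt
    rw [dist_eq_norm, norm_sub_rev]
    linarith [hrad m, (hS (m + 1)).radius_pos]
  have he : ∀ m, dist (S m).dir (S (m + 1)).dir ≤ 1 / 8 * (1 / 16) ^ m := by
    intro m
    have h1 := (hS m).norm_dir_sub_le (hN m).mem
    rw [dist_eq_norm, norm_sub_rev]
    unfold incrTol at h1
    linarith
  have hp : ∀ m, dist (S m).slope (S (m + 1)).slope ≤ 1 / 4 * (1 / 16) ^ m := by
    intro m
    have h1 := (hS m).abs_slope_sub_le (hN m).mem
    rw [dist_comm, Real.dist_eq]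
    unfold incrTol at h1
    linarith
  have hv : ∀ m, dist (S m).tilt (S (m + 1)).tilt ≤ 1 / 8 * (1 / 2) ^ m := by
    intro m
    rw [(hN m).tilt_eq, SearchState.nextTilt, dist_self_add_right, norm_smul,
      (hS m).admissible.1, Real.norm_of_nonneg (tiltSize_pos m).le, mul_one, tiltSize]
  obtain ⟨x, hx'⟩ := cauchySeq_tendsto_of_complete
    (cauchySeq_of_le_geometric _ _ (by norm_num) hx)
  obtain ⟨e, he'⟩ := cauchySeq_tendsto_of_complete
    (cauchySeq_of_le_geometric _ _ (by norm_num) he)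
  obtain ⟨p, hp'⟩ := cauchySeq_tendsto_of_complete
    (cauchySeq_of_le_geometric _ _ (by norm_num) hp)
  obtain ⟨v, hv'⟩ := cauchySeq_tendsto_of_complete
    (cauchySeq_of_le_geometric _ _ (by norm_num) hv)
  refine ⟨⟨x, e, p⟩, v, hx', he', hp', hv', fun m => ?_, fun m => ?_⟩
  · have h1 : ‖x - (S (m + 1)).pt‖ ≤ (S (m + 1)).radius := by
      refine le_of_tendsto ((hx'.sub_const _).norm) ?_
      filter_upwards [eventually_ge_atTop (m + 1)] with k hk
      have := norm_pt_sub_add_radius_le hN hk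
      linarith [(hS k).radius_pos]
    have h2 := (hN m).radius_add_lt
    have h3 := norm_sub_le_norm_sub_add_norm_sub x (S (m + 1)).pt (S m).pt
    change ‖x - (S m).pt‖ < (S m).radius
    linarith
  · have h1 := dist_le_of_le_geometric_of_tendsto (1 / 16) (1 / 8) (by norm_num) he he' m
    rw [dist_eq_norm] at h1
    refine h1.trans (le_of_eq ?_)
    unfold incrTol
    ring

/-- The increments at the limit point are close to those at every state, since all later
states are candidates at stage `m`, with a gain of slope of at most `maxTol K m`. -/
theorem incrClose_limit (hf : Continuous f) (hK : 0 ≤ K) (hS : ∀ m, (S m).Good f M K m)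
    (hN : ∀ m, (S m).Next f M K m (S (m + 1))) {x : E}
    (hx : Tendsto (fun m => (S m).pt) atTop (𝓝 x)) (m : ℕ) :
    IncrClose f (S m).dir (S m).pt x (2 * incrTol m) := by
  intro t
  have h1 : Tendsto (fun k => |(f ((S k).pt + t • (S m).dir) - f (S k).pt) -
      (f ((S m).pt + t • (S m).dir) - f (S m).pt)|) atTop
      (𝓝 |(f (x + t • (S m).dir) - f x) - (f ((S m).pt + t • (S m).dir) - f (S m).pt)|) := by
    refine Tendsto.abs (Tendsto.sub_const (Tendsto.sub ?_ ?_) _)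
    · exact (hf.tendsto _).comp (hx.add_const _)
    · exact (hf.tendsto _).comp hx
  refine le_of_tendsto h1 ?_
  filter_upwards [eventually_gt_atTop m] with k hk
  have hmem := mem_candidates_of_lt hN hk
  obtain ⟨-, -, -, -, σ, hσ, h2⟩ := id hmem
  refine (h2 t).trans (mul_le_mul_of_nonneg_right ?_ (abs_nonneg t))
  have h3 : K * √((S k).val ((S m).nextTilt (tiltSize m)) -
      (S m).val ((S m).nextTilt (tiltSize m))) ≤ K * √(maxTol K m) :=
    mul_le_mul_of_nonneg_left (Real.sqrt_le_sqrt ((hS m).gain_le hmem)) hK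
  linarith [mul_sqrt_maxTol_le (K := K) m]

/-- The increments at the limit point are within `2 * incrTol m` of those at the state `m`, which
has a directional derivative; hence so has the limit. -/
theorem hasLineDerivAt_limit (hf : LipschitzWith 1 f) (hS : ∀ m, (S m).Good f M K m)
    {P : DirPoint E} (hp : Tendsto (fun m => (S m).slope) atTop (𝓝 P.slope))
    (he : ∀ m, ‖(S m).dir - P.dir‖ ≤ incrTol m * (2 / 15))
    (hincr : ∀ m, IncrClose f (S m).dir (S m).pt P.pt (2 * incrTol m)) :
    HasLineDerivAt ℝ f P.slope P.pt P.dir := by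
  rw [hasLineDerivAt_iff_isLittleO_nhds_zero, Asymptotics.isLittleO_iff]
  intro c hc
  have h1 : ∀ᶠ m in atTop, incrTol m < c / 8 :=
    tendsto_incrTol.eventually (gt_mem_nhds (by positivity))
  have h2 : ∀ᶠ m in atTop, |(S m).slope - P.slope| < c / 8 := by
    filter_upwards [Metric.tendsto_nhds.1 hp (c / 8) (by positivity)] with m hm using hm
  obtain ⟨m, hm₁, hm₂⟩ := (h1.and h2).exists
  obtain ⟨τ, hτ, h3⟩ := HasLineDerivAt.exists_abs_sub_le (hS m).admissible.2
    (show 0 < c / 8 by positivity)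
  filter_upwards [Metric.ball_mem_nhds (0 : ℝ) hτ] with t ht
  rw [mem_ball_zero_iff, Real.norm_eq_abs] at ht
  have e1 := h3 t ht
  have e2 := hincr m t
  have e3 := abs_increment_sub_increment_le hf P.pt (S m).dir P.dir t
  have e4 : ‖(S m).dir - P.dir‖ * |t| ≤ c / 8 * |t| := by
    refine mul_le_mul_of_nonneg_right ?_ (abs_nonneg t)
    linarith [he m, incrTol_pos m]
  have e5 : |t * (S m).slope - t * P.slope| ≤ c / 8 * |t| := by
    rw [← mul_sub, abs_mul, mul_comm]
    exact mul_le_mul_of_nonneg_right hm₂.le (abs_nonneg t)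
  have e6 : 2 * incrTol m * |t| ≤ c / 4 * |t| := by
    refine mul_le_mul_of_nonneg_right ?_ (abs_nonneg t)
    linarith
  have e7 : 0 ≤ c * |t| := by positivity
  rw [smul_eq_mul, Real.norm_eq_abs, Real.norm_eq_abs]
  rw [abs_le] at e1 e2 e3 e5 ⊢
  obtain ⟨e1, e1'⟩ := e1
  obtain ⟨e2, e2'⟩ := e2
  obtain ⟨e3, e3'⟩ := e3
  obtain ⟨e5, e5'⟩ := e5
  constructor <;> linarith

/-- The gain of a fixed competitor over the successive states, with respect to the successive tilted
functions, decreases along the search. -/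
theorem antitone_gain (hS : ∀ m, (S m).Good f M K m)
    (hN : ∀ m, (S m).Next f M K m (S (m + 1))) {Q : DirPoint E} (hQ : Q.Admissible f) :
    Antitone fun m => Q.val (S (m + 1)).tilt - (S m).val (S (m + 1)).tilt := by
  refine antitone_nat_of_succ_le fun m => ?_
  have h1 := (hN m).mem.2.2.2.1
  rw [← (hN m).tilt_eq] at h1
  have h2 := inner_le_one_of_norm_eq_one (hS (m + 1)).admissible.1 hQ.1
  have h3 := tiltSize_pos (m + 1)
  rw [(hN (m + 1)).tilt_eq, SearchState.nextTilt, DirPoint.val_add_smul, DirPoint.val_add_smul,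
    real_inner_self_eq_norm_sq, (hS (m + 1)).admissible.1]
  nlinarith

/-- A point and a direction of almost locally maximal directional derivative: after a small linear
perturbation `⟪v, ·⟫` of `f`, there is a pair `P`, located in some `M i`, such that no nearby pair
located in a slightly larger `M j` whose increments are comparable to those at `P` has a
noticeably larger directional derivative. -/
theorem exists_almostMaximal [CompleteSpace E] (hf : LipschitzWith 1 f)
    (hM : Monotone M) (hMc : ∀ i, IsClosed (M i)) (hK : 0 ≤ K)
    {a b : ℝ} (hab : a < b) {y : E} {d : ℝ}
    (hstart : ∃ P : DirPoint E, P.Admissible f ∧ P.pt ∈ M a ∧ ‖P.pt - y‖ < d) :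
    ∃ (P : DirPoint E) (v : E) (i : ℝ), P.Admissible f ∧ ‖v‖ ≤ 1 / 4 ∧ ‖P.pt - y‖ ≤ d ∧
      a ≤ i ∧ i < b ∧ P.pt ∈ M i ∧
      ∀ ε > 0, ∃ δ > 0, ∃ j, i < j ∧ j ≤ b ∧ ∀ Q : DirPoint E, Q.Admissible f → Q.pt ∈ M j →
        ‖Q.pt - P.pt‖ < δ → P.val v ≤ Q.val v →
        IncrClose f P.dir P.pt Q.pt (K * √(Q.val v - P.val v)) → Q.val v < P.val v + ε := by
  obtain ⟨S, hS, hN, hlow, hupp, hball⟩ := exists_searchSeq hf hM hK hab hstart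
  obtain ⟨P, v, hx, he, hp, hv, hxr, her⟩ := exists_limits hS hN
  have hincr := incrClose_limit hf.continuous hK hS hN hx
  have hupper : StrictAnti fun m => (S m).upper :=
    strictAnti_nat_of_succ_lt fun m => (hN m).upper_lt
  have hlower : Monotone fun m => (S m).lower := monotone_nat_of_le_succ fun m => (hN m).lower_le
  have hlu : ∀ k m, (S k).lower ≤ (S m).upper := fun k m =>
    (hlower (le_max_left k m)).trans ((hS (max k m)).lower_lt.le.trans
      (hupper.antitone (le_max_right k m)))
  have hbdd : BddAbove (Set.range fun m => (S m).lower) :=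
    ⟨(S 0).upper, by rintro _ ⟨k, rfl⟩; exact hlu k 0⟩
  -- the index of the limit point
  set i := ⨆ m, (S m).lower with hi
  have hiu : ∀ m, i < (S m).upper := fun m =>
    (ciSup_le fun k => hlu k (m + 1)).trans_lt (hN m).upper_lt
  have hPadm : P.Admissible f := by
    refine ⟨?_, hasLineDerivAt_limit hf hS hp her hincr⟩
    refine tendsto_nhds_unique he.norm ?_
    simp only [fun m => (hS m).admissible.1]
    exact tendsto_const_nhds
  have hPM : P.pt ∈ M i := (hMc i).mem_of_tendsto hx
    (Eventually.of_forall fun m => hM (le_ciSup hbdd m) (hS m).pt_mem)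
  have hvnorm : ‖v‖ ≤ 1 / 4 := by
    refine le_of_tendsto hv.norm (Eventually.of_forall fun m => (hS m).norm_tilt.trans ?_)
    have : (0 : ℝ) ≤ (1 / 2) ^ m := by positivity
    linarith
  have hPy : ‖P.pt - y‖ ≤ d := by
    have h1 := norm_sub_le_norm_sub_add_norm_sub P.pt (S 0).pt y
    linarith [hxr 0]
  refine ⟨P, v, i, hPadm, hvnorm, hPy, hlow.trans (le_ciSup hbdd 0), hupp ▸ hiu 0, hPM, ?_⟩
  intro ε hε
  have hval : Tendsto (fun m => (S m).val (S m).tilt) atTop (𝓝 (P.val v)) :=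
    hp.add (hv.inner he)
  have ev1 : ∀ᶠ m in atTop, (S m).val (S m).tilt < P.val v + ε / 4 :=
    hval.eventually (gt_mem_nhds (by linarith))
  have ev2 : ∀ᶠ m in atTop, ‖(S m).tilt - v‖ < ε / 4 := by
    filter_upwards [Metric.tendsto_nhds.1 hv (ε / 4) (by positivity)] with m hm
    rwa [dist_eq_norm] at hm
  have ev3 : ∀ᶠ m in atTop, incrTol m < ε / 4 :=
    tendsto_incrTol.eventually (gt_mem_nhds (by positivity))
  obtain ⟨m, hm₁, hm₂, hm₃⟩ := (ev1.and (ev2.and ev3)).exists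
  refine ⟨(S (m + 1)).radius - ‖P.pt - (S (m + 1)).pt‖, sub_pos.2 (hxr (m + 1)),
    (S (m + 2)).upper, hiu _, hupp ▸ hupper.antitone (Nat.zero_le _), ?_⟩
  intro Q hQ hQM hQP hPQ hQincr
  -- the gain over `P` is at most the gain over every state
  have hgain : ∀ k, Q.val v - P.val v ≤ Q.val (S (k + 1)).tilt - (S k).val (S (k + 1)).tilt := by
    refine (antitone_gain hS hN hQ).le_of_tendsto ?_
    have hv' := hv.comp (tendsto_add_atTop_nat 1)
    exact (tendsto_const_nhds.add (hv'.inner tendsto_const_nhds)).sub (hp.add (hv'.inner he))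
  have hg := hgain (m + 1)
  rw [(hN (m + 1)).tilt_eq] at hg
  have hmem : Q ∈ candidates f M K (tiltSize (m + 1)) (4 * incrTol (m + 1)) (S (m + 1)) := by
    refine ⟨hQ, ⟨_, (hN (m + 1)).upper_lt, hQM⟩, ?_, by linarith, 3 * incrTol (m + 1),
      by linarith [incrTol_pos (m + 1)], fun t => ?_⟩
    · have h1 := norm_sub_le_norm_sub_add_norm_sub Q.pt P.pt (S (m + 1)).pt
      linarith
    · have e1 := hQincr t
      have e2 := hincr (m + 1) t
      have e3 := abs_increment_sub_increment_le hf Q.pt (S (m + 1)).dir P.dir t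
      have e4 := abs_increment_sub_increment_le hf P.pt (S (m + 1)).dir P.dir t
      have e5 : ‖(S (m + 1)).dir - P.dir‖ * |t| ≤ incrTol (m + 1) * (2 / 15) * |t| :=
        mul_le_mul_of_nonneg_right (her (m + 1)) (abs_nonneg t)
      have e6 : K * √(Q.val v - P.val v) * |t| ≤
          K * √(Q.val ((S (m + 1)).nextTilt (tiltSize (m + 1))) -
            (S (m + 1)).val ((S (m + 1)).nextTilt (tiltSize (m + 1)))) * |t| :=
        mul_le_mul_of_nonneg_right (mul_le_mul_of_nonneg_left (Real.sqrt_le_sqrt hg) hK)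
          (abs_nonneg t)
      have e7 : 0 ≤ incrTol (m + 1) * |t| := mul_nonneg (incrTol_pos _).le (abs_nonneg t)
      rw [add_mul]
      generalize K * √(Q.val v - P.val v) * |t| = G at *
      generalize K * √(Q.val ((S (m + 1)).nextTilt (tiltSize (m + 1))) -
            (S (m + 1)).val ((S (m + 1)).nextTilt (tiltSize (m + 1)))) * |t| = G' at *
      rw [abs_le] at e1 e2 e3 e4 ⊢
      obtain ⟨e1, e1'⟩ := e1
      obtain ⟨e2, e2'⟩ := e2
      obtain ⟨e3, e3'⟩ := e3
      obtain ⟨e4, e4'⟩ := e4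
      constructor <;> linarith
  have hmax := (hS m).le_max Q ((hN m).subset hmem)
  have h1 : |⟪(S m).tilt - v, Q.dir⟫| ≤ ‖(S m).tilt - v‖ * ‖Q.dir‖ := abs_real_inner_le_norm _ _
  rw [hQ.1, mul_one, inner_sub_left] at h1
  have h2 := (abs_le.1 h1).1
  have h3 := maxTol_le_incrTol K m
  have h4 := incrTol_pos m
  unfold DirPoint.val at *
  linarith

end Search

end NullSet

end

noncomputable section

namespace NullSet

open scoped RealInnerProductSpace

/-! ### Differentiability at a pair of almost maximal directional derivative -/

section Wedge

variable {E : Type*} [NormedAddCommGroup E] [InnerProductSpace ℝ E]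

/-- The continuous function on the line that equals `a` on `(-∞, -s]`, `b` at `0` and `c` on
`[s, ∞)` and is affine in between. -/
def hat (s : ℝ) (a b c : E) (t : ℝ) : E :=
  b + max 0 (min 1 (-t / s)) • (a - b) + max 0 (min 1 (t / s)) • (c - b)

theorem hat_of_mem_Icc {s : ℝ} (hs : 0 < s) (a b c : E) {t : ℝ} (h0 : 0 ≤ t) (h1 : t ≤ s) :
    hat s a b c t = b + (t / s) • (c - b) := by
  have e1 : -t / s ≤ 0 := div_nonpos_of_nonpos_of_nonneg (by linarith) hs.le
  have e2 : 0 ≤ t / s := by positivity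
  have e3 : t / s ≤ 1 := (div_le_one hs).2 h1
  simp [hat, max_eq_left ((min_le_right _ _).trans e1), max_eq_right e2, min_eq_right e3]

theorem hat_neg (s : ℝ) (a b c : E) (t : ℝ) : hat s a b c (-t) = hat s c b a t := by
  simp only [hat, neg_neg]
  abel

theorem hat_of_le {s : ℝ} (hs : 0 < s) (a b c : E) {t : ℝ} (h1 : s ≤ t) :
    hat s a b c t = c := by
  have e1 : -t / s ≤ 0 := div_nonpos_of_nonpos_of_nonneg (by linarith) hs.le
  have e3 : 1 ≤ t / s := (one_le_div hs).2 h1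
  simp [hat, max_eq_left ((min_le_right _ _).trans e1), min_eq_left e3]

theorem hat_of_le_neg {s : ℝ} (hs : 0 < s) (a b c : E) {t : ℝ} (h1 : t ≤ -s) :
    hat s a b c t = a := by
  rw [← neg_neg t, hat_neg, hat_of_le hs _ _ _ (by linarith)]

theorem abs_clamp_sub_clamp_le (l u x y : ℝ) :
    |max l (min u x) - max l (min u y)| ≤ |x - y| := by
  have h := ((LipschitzWith.id (α := ℝ)).const_min u).const_max l |>.dist_le_mul x y
  simpa [Real.dist_eq] using h

theorem norm_hat_sub_hat_le {s : ℝ} (hs : 0 < s) (a b c : E) (t u : ℝ) :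
    ‖hat s a b c t - hat s a b c u‖ ≤ (‖a - b‖ + ‖c - b‖) / s * |t - u| := by
  have key : hat s a b c t - hat s a b c u =
      (max 0 (min 1 (-t / s)) - max 0 (min 1 (-u / s))) • (a - b) +
        (max 0 (min 1 (t / s)) - max 0 (min 1 (u / s))) • (c - b) := by
    simp only [hat, sub_smul]; abel
  have e1 : |max 0 (min 1 (-t / s)) - max 0 (min 1 (-u / s))| ≤ |t - u| / s := by
    refine (abs_clamp_sub_clamp_le _ _ _ _).trans (le_of_eq ?_)
    rw [← sub_div, abs_div, abs_of_pos hs, neg_sub_neg, abs_sub_comm]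
  have e2 : |max 0 (min 1 (t / s)) - max 0 (min 1 (u / s))| ≤ |t - u| / s := by
    refine (abs_clamp_sub_clamp_le _ _ _ _).trans (le_of_eq ?_)
    rw [← sub_div, abs_div, abs_of_pos hs]
  rw [key]
  refine (norm_add_le _ _).trans ?_
  rw [norm_smul, norm_smul, Real.norm_eq_abs, Real.norm_eq_abs]
  calc _ ≤ |t - u| / s * ‖a - b‖ + |t - u| / s * ‖c - b‖ := by gcongr
    _ = _ := by ring

/-- Away from the corners the curve `t ↦ z + t e + hat t` runs through the two segments of the
wedge, with a velocity of the form `e + q`. -/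
theorem exists_velocity {s : ℝ} (hs : 0 < s) (z e a b c : E) {S : Set E}
    (h1 : segment ℝ (z - s • e + a) (z + b) ⊆ S) (h2 : segment ℝ (z + b) (z + s • e + c) ⊆ S)
    {τ : ℝ} (hτ : |τ| < s) (hτ0 : τ ≠ 0) :
    z + τ • e + hat s a b c τ ∈ S ∧ ∃ q : E, (q = (1 / s) • (b - a) ∨ q = (1 / s) • (c - b)) ∧
      ∀ᶠ t in 𝓝 (0 : ℝ), hat s a b c (τ + t) = hat s a b c τ + t • q := by
  have hpos : ∀ (a b c e : E) (τ : ℝ), 0 < τ → τ < s →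
      z + τ • e + hat s a b c τ ∈ segment ℝ (z + b) (z + s • e + c) ∧
      ∀ᶠ t in 𝓝 (0 : ℝ), hat s a b c (τ + t) = hat s a b c τ + t • ((1 / s) • (c - b)) := by
    intro a b c e τ hτ0 hτs
    constructor
    · rw [segment_eq_image']
      refine ⟨τ / s, ⟨by positivity, (div_le_one hs).2 hτs.le⟩, ?_⟩
      have : (τ / s) • (s • e) = τ • e := by rw [smul_smul, div_mul_cancel₀ _ hs.ne']
      simp only [hat_of_mem_Icc hs a b c hτ0.le hτs.le, smul_sub, smul_add, this]
      abel
    · have hnhds : ∀ᶠ t in 𝓝 (0 : ℝ), τ + t ∈ Set.Ioo 0 s := by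
        have : Tendsto (fun t : ℝ => τ + t) (𝓝 0) (𝓝 τ) := by
          simpa using (continuous_const_add τ).tendsto 0
        exact this (Ioo_mem_nhds hτ0 hτs)
      filter_upwards [hnhds] with t ht
      rw [hat_of_mem_Icc hs a b c hτ0.le hτs.le, hat_of_mem_Icc hs a b c ht.1.le ht.2.le, add_div,
        add_smul, smul_smul, add_assoc]
      congr 3
      ring
  rcases lt_or_gt_of_ne hτ0 with h | h
  · obtain ⟨e1, e2⟩ := hpos c b a (-e) (-τ) (by linarith) (by linarith [neg_lt_of_abs_lt hτ])
    rw [← hat_neg, neg_neg, neg_smul_neg, smul_neg, ← sub_eq_add_neg] at e1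
    refine ⟨h1 (segment_symm ℝ (z + b) _ ▸ e1), _, Or.inl rfl, ?_⟩
    have hneg : Tendsto (fun t : ℝ => -t) (𝓝 0) (𝓝 0) := by
      simpa using (continuous_neg (G := ℝ)).tendsto 0
    filter_upwards [hneg.eventually e2] with t ht
    rw [← neg_add, hat_neg, hat_neg] at ht
    rw [ht, neg_smul, ← smul_neg, ← smul_neg, neg_sub]
  · obtain ⟨e1, e2⟩ := hpos a b c e τ h (lt_of_abs_lt hτ)
    exact ⟨h2 e1, _, Or.inr rfl, e2⟩

/-- The one-dimensional lemma for a function that is not constant but tiny on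
`s ≤ |u| ≤ s / β + s`, obtained by freezing it outside `[-s, s]`. -/
theorem exists_deriv_ge_of_tiny_outside {h : ℝ → ℝ} {β s : ℝ}
    (hhlip : ∀ t u, |h t - h u| ≤ 3 * |t - u|) (hβ : 0 < β) (hβ1 : β ≤ 1 / 10) (hs : 0 < s)
    (hfar : ∀ u : ℝ, s ≤ |u| → |u| ≤ s / β + s →
      |h u| ≤ β ^ 3 / 4 * s + β ^ 4 / 2 * (|u| + 2 * s))
    (hdev : 400 * β ^ 2 * s ≤ |h 0|) :
    ∃ τ g, |τ| < s ∧ τ ≠ 0 ∧ 16 * β ^ 2 ≤ g ∧ HasDerivAt h g τ ∧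
      ∀ t, |t| ≤ s / β → |h (τ + t) - h τ| ≤ 201 * √g * |t| := by
  have hβ3 : β ^ 3 ≤ β ^ 2 * (1 / 10) := by rw [pow_succ]; gcongr
  have hβ4 : β ^ 4 ≤ β ^ 3 * (1 / 10) := by rw [pow_succ β 3]; gcongr
  have hβ2 : β ^ 2 ≤ β * (1 / 10) := by rw [pow_two]; gcongr
  have hβ2s : 0 < β ^ 2 * s := by positivity
  have hsβ : 10 * s ≤ s / β := by rw [le_div_iff₀ hβ]; nlinarith only [hβ1, hs]
  have hs4 : β ^ 4 * s ≤ β ^ 2 * s := mul_le_mul_of_nonneg_right (by linarith [sq_nonneg β]) hs.le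
  have hs3 : β ^ 3 * s ≤ β ^ 2 * s := mul_le_mul_of_nonneg_right (by linarith [sq_nonneg β]) hs.le
  have hend : |h s| ≤ 2 * β ^ 2 * s ∧ |h (-s)| ≤ 2 * β ^ 2 * s := by
    have e1 := hfar s (le_abs_self s) (by rw [abs_of_pos hs]; linarith)
    have e2 := hfar (-s) (by rw [abs_neg]; exact le_abs_self s)
      (by rw [abs_neg, abs_of_pos hs]; linarith)
    rw [abs_neg] at e2
    rw [abs_of_pos hs] at e1 e2
    constructor <;> linarith
  -- the point provided by the one-dimensional lemma
  set clamp : ℝ → ℝ := fun t => max (-s) (min s t) with hclamp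
  have hclamp_in : ∀ t, |t| ≤ s → clamp t = t := by
    intro t ht
    rw [abs_le] at ht
    simp [hclamp, ht.1, ht.2]
  have hclamp_r : ∀ t, s ≤ t → clamp t = s := by
    intro t ht
    simp only [hclamp, min_eq_left ht]
    exact max_eq_right (by linarith)
  have hclamp_l : ∀ t, t ≤ -s → clamp t = -s := by
    intro t ht
    simp only [hclamp, min_eq_right (show t ≤ s by linarith)]
    exact max_eq_left ht
  have hclamp_s : clamp s = s := hclamp_r s le_rfl
  have hclamp_ns : clamp (-s) = -s := hclamp_l _ le_rfl
  have hclamp_0 : clamp 0 = 0 := hclamp_in 0 (by simpa using hs.le)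
  obtain ⟨τ, hτ, hτ0, hτdiff, hτg, hτinc⟩ := exists_deriv_ge_and_abs_sub_le
    (h := fun t => h (clamp t)) (s := s) (α := 128 * β ^ 2 * s) (θ := 2 * β ^ 2)
    (LipschitzWith.of_dist_le_mul fun t u => by
      rw [Real.dist_eq, Real.dist_eq]
      refine (hhlip _ _).trans ?_
      refine mul_le_mul_of_nonneg_left (abs_clamp_sub_clamp_le _ _ _ _) ?_
      norm_num)
    hs (by positivity) (by positivity) (by linarith)
    (fun t ht => by simp only [hclamp_r t ht, hclamp_s])
    (fun t ht => by simp only [hclamp_l t ht, hclamp_ns])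
    (by
      simp only [hclamp_0, hclamp_ns]
      have := abs_sub_abs_le_abs_sub (h 0) (h (-s))
      linarith [hend.2])
    (by
      simp only [hclamp_s, hclamp_ns]
      have := abs_sub (h s) (h (-s))
      linarith [hend.1, hend.2])
  have hτs : |τ| < s := lt_of_lt_of_le hτ (by linarith)
  set g := deriv (fun t => h (clamp t)) τ with hg
  have hg16 : 16 * β ^ 2 ≤ g := by
    refine le_trans (le_of_eq ?_) hτg
    field_simp
    norm_num
  have hgpos : 0 < g := lt_of_lt_of_le (by positivity) hg16
  have hsg : 4 * β ≤ √g := Real.le_sqrt_of_sq_le (by linarith)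
  have hderiv : HasDerivAt h g τ := by
    refine hτdiff.hasDerivAt.congr_of_eventuallyEq ?_
    have : ∀ᶠ t in 𝓝 τ, |t| < s := (continuous_abs.tendsto τ).eventually (gt_mem_nhds hτs)
    filter_upwards [this] with t ht
    rw [hclamp_in t ht.le]
  refine ⟨τ, g, hτs, hτ0, hg16, hderiv, fun t ht => ?_⟩
  -- outside `[-s, s]` the function `h` is tiny compared with `|t|`
  have e3 : |h (τ + t) - h (clamp (τ + t))| ≤ √g * |t| := by
    by_cases hu : |τ + t| ≤ s
    · rw [hclamp_in _ hu, sub_self, abs_zero]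
      positivity
    · rw [not_le] at hu
      have f1 : |τ + t| ≤ |τ| + |t| := abs_add_le _ _
      have f2 := hfar (τ + t) hu.le (by linarith)
      have f3 : |h (clamp (τ + t))| ≤ β ^ 3 / 4 * s + β ^ 4 / 2 * (3 * s) := by
        rcases lt_abs.1 hu with h' | h'
        · rw [hclamp_r _ h'.le]
          have := hfar s (le_abs_self s) (by rw [abs_of_pos hs]; linarith)
          rw [abs_of_pos hs] at this
          linarith
        · rw [hclamp_l _ (by linarith)]
          have := hfar (-s) (by rw [abs_neg]; exact le_abs_self s)
            (by rw [abs_neg, abs_of_pos hs]; linarith)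
          rw [abs_neg, abs_of_pos hs] at this
          linarith
      have f4 : 2 * β ^ 2 * s ≤ |t| := by linarith
      have f5 : β ^ 4 / 2 * (|τ + t| + 2 * s) ≤ β ^ 4 / 2 * (s / β + 3 * s) := by
        refine mul_le_mul_of_nonneg_left ?_ (by positivity)
        linarith
      have f6 : β ^ 4 / 2 * (s / β + 3 * s) = β ^ 3 / 2 * s + β ^ 4 / 2 * (3 * s) := by
        field_simp
      have f7 : β ^ 4 * s ≤ β ^ 3 * s := mul_le_mul_of_nonneg_right
        (pow_le_pow_of_le_one hβ.le (by linarith only [hβ1]) (by norm_num)) hs.le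
      have f8 : 4 * β * (2 * β ^ 2 * s) ≤ √g * |t| :=
        mul_le_mul hsg f4 (by positivity) (Real.sqrt_nonneg _)
      have f9 : 0 ≤ β ^ 3 * s := by positivity
      refine (abs_sub _ _).trans ?_
      linarith
  have e4 := hτinc t
  rw [hclamp_in τ hτs.le] at e4
  rw [abs_le] at e3 e4 ⊢
  constructor <;> linarith [e3.1, e3.2, e4.1, e4.2]

theorem abs_norm_add_sub_one_le {e q : E} {β : ℝ} (he : ‖e‖ = 1) (hβ : 0 < β) (hβ1 : β ≤ 1 / 10)
    (hqnorm : ‖q‖ ≤ 2 * β ∧ |⟪e, q⟫| ≤ β ^ 3 / 2) : |‖e + q‖ - 1| ≤ 5 * β ^ 2 := by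
  have hβ3 : β ^ 3 ≤ β ^ 2 * (1 / 10) := by rw [pow_succ]; gcongr
  have e1 : ‖e + q‖ ^ 2 = 1 + 2 * ⟪e, q⟫ + ‖q‖ ^ 2 := by
    rw [@norm_add_sq_real, he]; ring
  have e2 : ‖q‖ ^ 2 ≤ 4 * β ^ 2 := by nlinarith [norm_nonneg q, hqnorm.1]
  have e3 := abs_le.1 hqnorm.2
  have e4 : |(‖e + q‖ - 1) * (‖e + q‖ + 1)| ≤ 5 * β ^ 2 := by
    rw [abs_le]
    constructor <;> nlinarith only [sq_nonneg ‖q‖, e1, e2, e3.1, e3.2, hβ3, sq_nonneg β]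
  rw [abs_mul, abs_of_nonneg (by positivity : 0 ≤ ‖e + q‖ + 1)] at e4
  nlinarith [abs_nonneg (‖e + q‖ - 1), norm_nonneg (e + q)]

theorem div_four_le_inv_mul_sub {g p N β : ℝ} (hp : |p| ≤ 1) (hβ : 0 < β) (hβ1 : β ≤ 1 / 10)
    (hg : 16 * β ^ 2 ≤ g) (hN : |N - 1| ≤ 5 * β ^ 2) : g / 4 ≤ N⁻¹ * (g + p) - p := by
  have hN1 := abs_le.1 hN
  have hβ2 : β ^ 2 ≤ 1 / 100 := by nlinarith
  have hNpos : 0 < N := by linarith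
  have e1 : |p * (1 - N)| ≤ 5 * β ^ 2 := by
    rw [abs_mul, abs_sub_comm]
    nlinarith [abs_nonneg p, abs_nonneg (N - 1)]
  have e2 := (abs_le.1 e1).1
  have e3 : N⁻¹ * (g + p) - p = (g + p * (1 - N)) / N := by
    field_simp
    ring
  have hg0 : 0 ≤ g := by nlinarith
  rw [e3, le_div_iff₀ hNpos]
  nlinarith

/-- If `F` deviates at `z + b` from its linear behaviour along the line `z + ℝ e`, then there is a
better direction on any wedge through `z + b` with end points near `z ± s e`. -/
theorem exists_better_dirPoint {F : E → ℝ} (hF : LipschitzWith 1 F) {x e : E} {p ζ β s : ℝ}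
    (he : ‖e‖ = 1) (hp : |p| ≤ 1) (hβ : 0 < β) (hβ1 : β ≤ 1 / 10) (hs : 0 < s) (hζ : |ζ| ≤ s)
    (hd : ∀ u : ℝ, |u| ≤ 3 * (s / β) → |F (x + u • e) - F x - u * p| ≤ β ^ 4 / 2 * |u|)
    {a b c : E} (ha : ‖a‖ ≤ β ^ 3 / 4 * s) (hc : ‖c‖ ≤ β ^ 3 / 4 * s)
    (hb : ‖b‖ ≤ (β + β ^ 3 / 4) * s) (hbe : |⟪e, b⟫| ≤ β ^ 3 / 4 * s)
    (hdev : 400 * β ^ 2 * s ≤ |F (x + ζ • e + b) - F (x + ζ • e)|) {S : Set E}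
    (h1 : segment ℝ (x + ζ • e - s • e + a) (x + ζ • e + b) ⊆ S)
    (h2 : segment ℝ (x + ζ • e + b) (x + ζ • e + s • e + c) ⊆ S) :
    ∃ Q : DirPoint E, Q.Admissible F ∧ Q.pt ∈ S ∧ ‖Q.pt - x‖ ≤ 3 * s ∧
      p + 4 * β ^ 2 ≤ Q.slope ∧ IncrClose F e x Q.pt (406 * √(Q.slope - p)) := by
  set z := x + ζ • e with hz
  set w := hat s a b c with hw
  have hβ3 : β ^ 3 ≤ β ^ 2 * (1 / 10) := by rw [pow_succ]; gcongr
  have hβ4 : β ^ 4 ≤ β ^ 3 * (1 / 10) := by rw [pow_succ β 3]; gcongr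
  have hβ2 : β ^ 2 ≤ β * (1 / 10) := by rw [pow_two]; gcongr
  have hβ2s : 0 < β ^ 2 * s := by positivity
  have hsβ : 10 * s ≤ s / β := by rw [le_div_iff₀ hβ]; nlinarith only [hs, hβ1]
  have hab : ‖a - b‖ ≤ 2 * β * s := by
    refine (norm_sub_le _ _).trans ((add_le_add ha hb).trans ?_)
    rw [← add_mul]
    refine mul_le_mul_of_nonneg_right ?_ hs.le
    linarith
  have hcb : ‖c - b‖ ≤ 2 * β * s := by
    refine (norm_sub_le _ _).trans ((add_le_add hc hb).trans ?_)
    rw [← add_mul]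
    refine mul_le_mul_of_nonneg_right ?_ hs.le
    linarith
  have hwlip : ∀ t u, ‖w t - w u‖ ≤ 4 * β * |t - u| := by
    intro t u
    refine (norm_hat_sub_hat_le hs a b c t u).trans (mul_le_mul_of_nonneg_right ?_ (abs_nonneg _))
    rw [div_le_iff₀ hs]
    linarith
  -- linear behaviour along the line
  have hline : ∀ u : ℝ, |u| ≤ s / β + s →
      |F (z + u • e) - F z - p * u| ≤ β ^ 4 / 2 * (|u| + 2 * s) := by
    intro u hu
    have e0 : |ζ + u| ≤ |ζ| + |u| := abs_add_le _ _
    have e1 := hd (ζ + u) (by linarith)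
    have e2 := hd ζ (by linarith)
    have e3 : β ^ 4 / 2 * (|ζ + u| + |ζ|) ≤ β ^ 4 / 2 * (|u| + 2 * s) := by
      refine mul_le_mul_of_nonneg_left ?_ (by positivity)
      linarith
    rw [hz, add_assoc, ← add_smul]
    rw [abs_le] at e1 e2 ⊢
    constructor <;> linarith only [e1.1, e1.2, e2.1, e2.2, e3]
  -- the restriction of `F` to the wedge
  set h : ℝ → ℝ := fun t => F (z + t • e + w t) - F z - p * t with hh
  have hhlip : ∀ t u, |h t - h u| ≤ 3 * |t - u| := by
    intro t u
    have e1 := hF.dist_le_mul (z + t • e + w t) (z + u • e + w u)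
    rw [NNReal.coe_one, one_mul, Real.dist_eq, dist_eq_norm,
      show z + t • e + w t - (z + u • e + w u) = (t - u) • e + (w t - w u) by
        rw [sub_smul]; abel] at e1
    have e2 := norm_add_le ((t - u) • e) (w t - w u)
    rw [norm_smul, he, mul_one, Real.norm_eq_abs] at e2
    have e3 := hwlip t u
    have e4 : 4 * β * |t - u| ≤ |t - u| := mul_le_of_le_one_left (abs_nonneg _) (by linarith)
    have e5 : |p * (t - u)| ≤ |t - u| := by
      rw [abs_mul]; exact mul_le_of_le_one_left (abs_nonneg _) hp
    have e6 : |F (z + t • e + w t) - F (z + u • e + w u)| ≤ 2 * |t - u| := by linarith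
    have e7 : h t - h u = (F (z + t • e + w t) - F (z + u • e + w u)) - p * (t - u) := by
      simp only [hh]; ring
    rw [e7]
    refine (abs_sub _ _).trans ?_
    linarith
  have hfar : ∀ u : ℝ, s ≤ |u| → |u| ≤ s / β + s →
      |h u| ≤ β ^ 3 / 4 * s + β ^ 4 / 2 * (|u| + 2 * s) := by
    intro u hu hu'
    have e1 := hline u hu'
    have e2 : ‖w u‖ ≤ β ^ 3 / 4 * s := by
      rcases le_total 0 u with h0 | h0
      · rw [abs_of_nonneg h0] at hu
        rw [hw, hat_of_le hs _ _ _ hu]; exact hc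
      · rw [abs_of_nonpos h0] at hu
        rw [hw, hat_of_le_neg hs _ _ _ (by linarith)]; exact ha
    have e3 := hF.dist_le_mul (z + u • e + w u) (z + u • e)
    rw [NNReal.coe_one, one_mul, Real.dist_eq, dist_self_add_left] at e3
    have e4 : h u = (F (z + u • e + w u) - F (z + u • e)) + (F (z + u • e) - F z - p * u) := by
      simp only [hh]; ring
    rw [e4]
    refine (abs_add_le _ _).trans ?_
    linarith
  have hh0 : h 0 = F (z + b) - F z := by
    have : w 0 = b := by rw [hw, hat_of_mem_Icc hs a b c le_rfl hs.le]; simp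
    simp [hh, this]
  obtain ⟨τ, g, hτs, hτ0, hg16, hderiv, hτinc⟩ := exists_deriv_ge_of_tiny_outside hhlip hβ hβ1 hs
    hfar (hh0 ▸ hdev)
  have hgpos : 0 < g := lt_of_lt_of_le (by positivity) hg16
  have hsg : 4 * β ≤ √g := Real.le_sqrt_of_sq_le (by linarith)
  obtain ⟨hmem, q, hq, hqev⟩ := exists_velocity hs z e a b c h1 h2 hτs hτ0
  rw [← hw] at hmem hqev
  set x' := z + τ • e + w τ with hx'
  have hae : |⟪e, a⟫| ≤ β ^ 3 / 4 * s := by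
    refine (abs_real_inner_le_norm _ _).trans ?_
    rw [he, one_mul]; exact ha
  have hce : |⟪e, c⟫| ≤ β ^ 3 / 4 * s := by
    refine (abs_real_inner_le_norm _ _).trans ?_
    rw [he, one_mul]; exact hc
  have hqnorm : ‖q‖ ≤ 2 * β ∧ |⟪e, q⟫| ≤ β ^ 3 / 2 := by
    rcases hq with rfl | rfl
    · constructor
      · rw [norm_smul, Real.norm_of_nonneg (by positivity), norm_sub_rev, one_div,
          inv_mul_le_iff₀ hs]
        linarith
      · rw [real_inner_smul_right, inner_sub_right, abs_mul, abs_of_pos (by positivity), one_div,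
          inv_mul_le_iff₀ hs]
        refine (abs_sub _ _).trans ?_
        linarith
    · constructor
      · rw [norm_smul, Real.norm_of_nonneg (by positivity), one_div, inv_mul_le_iff₀ hs]
        linarith
      · rw [real_inner_smul_right, inner_sub_right, abs_mul, abs_of_pos (by positivity), one_div,
          inv_mul_le_iff₀ hs]
        refine (abs_sub _ _).trans ?_
        linarith
  -- the speed differs from `1` only to second order in `β`
  have hspeed := abs_norm_add_sub_one_le he hβ hβ1 hqnorm
  set N := ‖e + q‖ with hN
  have hN1 := abs_le.1 hspeed
  have hNpos : 0 < N := by linarith only [hN1.1, hβ2, hβ1]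
  have hlineDeriv : HasLineDerivAt ℝ F (g + p) x' (e + q) := by
    have e1 : HasDerivAt (fun t => h (τ + t) + F z + p * (τ + t)) (g + p * 1) 0 := by
      refine HasDerivAt.add (HasDerivAt.add_const _ ?_) ?_
      · exact HasDerivAt.comp_const_add τ 0 (by simpa using hderiv)
      · exact ((hasDerivAt_id (0 : ℝ)).const_add τ).const_mul p
    rw [mul_one] at e1
    refine HasDerivAt.congr_of_eventuallyEq e1 ?_
    filter_upwards [hqev] with t ht
    simp only [hh, ht, hx']
    rw [show z + τ • e + w τ + t • (e + q) = z + (τ + t) • e + (w τ + t • q) by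
      rw [add_smul, smul_add]; abel]
    ring
  set p' := N⁻¹ * (g + p) with hp'
  have hgain : g / 4 ≤ p' - p := div_four_le_inv_mul_sub hp hβ hβ1 hg16 hspeed
  have hsqrt : √g ≤ 2 * √(p' - p) := by
    have e1 : √(g / 4) ≤ √(p' - p) := Real.sqrt_le_sqrt hgain
    rw [Real.sqrt_div hgpos.le, show (4 : ℝ) = 2 ^ 2 by norm_num,
      Real.sqrt_sq (by norm_num)] at e1
    linarith
  have hx'x : ‖x' - x‖ ≤ 3 * s := by
    have e1 : x' - x = (ζ + τ) • e + w τ := by rw [hx', hz, add_smul]; abel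
    have e2 : ‖w τ‖ ≤ s := by
      have e3 := hwlip τ (-s)
      have e4 : w (-s) = a := hat_of_le_neg hs _ _ _ le_rfl
      rw [e4] at e3
      have e5 := norm_le_norm_add_norm_sub a (w τ)
      have e6 : |τ - -s| ≤ 2 * s := by
        rw [abs_le] at *
        rw [abs_lt] at hτs
        constructor <;> linarith [hτs.1, hτs.2]
      rw [norm_sub_rev] at e5
      have e7 : β * |τ - -s| ≤ 1 / 10 * (2 * s) := mul_le_mul hβ1 e6 (abs_nonneg _) (by norm_num)
      have e8 : β ^ 3 / 4 * s ≤ 1 / 10 * s := mul_le_mul_of_nonneg_right (by linarith) hs.le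
      linarith only [e3, e5, e7, e8, ha, hs]
    rw [e1]
    refine (norm_add_le _ _).trans ?_
    rw [norm_smul, he, mul_one, Real.norm_eq_abs]
    linarith [abs_add_le ζ τ]
  refine ⟨⟨x', N⁻¹ • (e + q), p'⟩, ⟨?_, ?_⟩, hmem, hx'x, ?_, fun t => ?_⟩
  · change ‖N⁻¹ • (e + q)‖ = 1
    rw [norm_smul, norm_inv, norm_norm, ← hN, inv_mul_cancel₀ hNpos.ne']
  · exact hlineDeriv.smul N⁻¹
  · change p + 4 * β ^ 2 ≤ p'
    linarith
  · change |F (x' + t • e) - F x' - (F (x + t • e) - F x)| ≤ 406 * √(p' - p) * |t|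
    have hfin : 203 * √g * |t| ≤ 406 * √(p' - p) * |t| :=
      mul_le_mul_of_nonneg_right (by linarith) (abs_nonneg t)
    refine le_trans ?_ hfin
    by_cases ht : |t| ≤ s / β
    · -- the increment along the wedge
      have e1 : |F (x' + t • e) - F x' - p * t - (h (τ + t) - h τ)| ≤ √g * |t| := by
        have e2 : F (x' + t • e) - F x' - p * t - (h (τ + t) - h τ) =
            F (x' + t • e) - F (z + (τ + t) • e + w (τ + t)) := by
          simp only [hh, hx']; ring
        have e3 := hF.dist_le_mul (x' + t • e) (z + (τ + t) • e + w (τ + t))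
        rw [NNReal.coe_one, one_mul, Real.dist_eq, dist_eq_norm,
          show x' + t • e - (z + (τ + t) • e + w (τ + t)) = w τ - w (τ + t) by
            rw [hx', add_smul]; abel] at e3
        rw [e2]
        refine e3.trans ((hwlip _ _).trans ?_)
        rw [sub_add_cancel_left, abs_neg]
        exact mul_le_mul_of_nonneg_right hsg (abs_nonneg t)
      have e2 : |F (x + t • e) - F x - t * p| ≤ √g * |t| := by
        refine (hd t (by linarith)).trans (mul_le_mul_of_nonneg_right ?_ (abs_nonneg t))
        linarith
      have e4 := hτinc t ht
      rw [abs_le] at e1 e2 e4 ⊢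
      obtain ⟨e1, e1'⟩ := e1
      obtain ⟨e2, e2'⟩ := e2
      obtain ⟨e4, e4'⟩ := e4
      constructor
      · linarith only [e1, e2', e4]
      · linarith only [e1', e2, e4']
    · -- for long increments the distance of the base points is negligible
      have e1 := hF.dist_le_mul (x' + t • e) (x + t • e)
      have e2 := hF.dist_le_mul x' x
      rw [dist_add_right] at e1
      rw [NNReal.coe_one, one_mul, Real.dist_eq, dist_eq_norm] at e1 e2
      have e3 : 4 * β * (s / β) ≤ √g * |t| :=
        mul_le_mul hsg (not_le.1 ht).le (by positivity) (Real.sqrt_nonneg _)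
      rw [mul_assoc, mul_div_cancel₀ _ hβ.ne'] at e3
      have e4 : |F (x' + t • e) - F x' - (F (x + t • e) - F x)| ≤ ‖x' - x‖ + ‖x' - x‖ := by
        rw [abs_le] at e1 e2 ⊢
        constructor <;> linarith only [e1.1, e1.2, e2.1, e2.2]
      linarith only [e3, e4, hx'x, hs]

/-- Wedges with vertices in a small ball around `x` can be approximated, up to an arbitrarily small
fraction of the radius, by wedges contained in `S`. -/
def WedgeApprox (S : Set E) (x : E) : Prop :=
  ∀ η > 0, ∃ δ > 0, ∀ r, 0 < r → r < δ → ∀ A B C : E, ‖A - x‖ ≤ r → ‖B - x‖ ≤ r → ‖C - x‖ ≤ r →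
    ∃ A' B' C' : E, ‖A' - A‖ ≤ η * r ∧ ‖B' - B‖ ≤ η * r ∧ ‖C' - C‖ ≤ η * r ∧
      segment ℝ A' B' ⊆ S ∧ segment ℝ B' C' ⊆ S

set_option maxHeartbeats 400000 in
/-- A pair of almost locally maximal directional derivative is a point of differentiability,
provided that the competing sets contain enough wedges. If `F` deviates from the expected
derivative by more than `ε ‖h‖` at `x + h`, the wedge through `x + h` with end points
`x + (⟪e, h⟫ ± s) e`, `s = ‖h‖ / β`, carries a better pair. Its slope exceeds the old one by
`4 β ^ 2`, where `β` is a fixed multiple of `ε`, however small `h` is. -/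
theorem hasFDerivAt_of_almostMaximal {F : E → ℝ} (hF : LipschitzWith 1 F) {P : DirPoint E}
    (hP : P.Admissible F)
    (hmax : ∀ ε > 0, ∃ δ > 0, ∃ S : Set E, WedgeApprox S P.pt ∧ ∀ Q : DirPoint E,
      Q.Admissible F → Q.pt ∈ S → ‖Q.pt - P.pt‖ < δ → P.slope ≤ Q.slope →
      IncrClose F P.dir P.pt Q.pt (406 * √(Q.slope - P.slope)) → Q.slope < P.slope + ε) :
    HasFDerivAt F (P.slope • innerSL ℝ P.dir) P.pt := by
  obtain ⟨x, e, p⟩ := P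
  obtain ⟨he, hderiv⟩ := hP
  dsimp only at he hderiv hmax ⊢
  have hp : |p| ≤ 1 := by
    have := hderiv.le_of_lipschitz hF
    simpa [he] using this
  rw [hasFDerivAt_iff_isLittleO_nhds_zero, Asymptotics.isLittleO_iff]
  intro ε hε
  set β := min (ε / 512) (1 / 10) with hβdef
  have hβ : 0 < β := lt_min (by positivity) (by norm_num)
  have hβ1 : β ≤ 1 / 10 := min_le_right _ _
  have hβε : 512 * β ≤ ε := by linarith [min_le_left (ε / 512) (1 / 10)]
  obtain ⟨δ, hδ, S, hS, hbest⟩ := hmax (4 * β ^ 2) (by positivity)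
  obtain ⟨τ, hτ, hd⟩ := HasLineDerivAt.exists_abs_sub_le hderiv
    (show 0 < β ^ 4 / 2 by positivity)
  obtain ⟨δ', hδ', hwedge⟩ := hS (β ^ 3 / 8) (by positivity)
  -- the bounds needed on `s = ‖h‖ / β`, times `β`
  set r₀ := β * min (min (δ / 4) (δ' / 4)) (τ * β / 4) with hr₀
  have hr₀pos : 0 < r₀ := by positivity
  filter_upwards [Metric.ball_mem_nhds (0 : E) hr₀pos] with h hh
  rw [mem_ball_zero_iff] at hh
  by_cases hh0 : h = 0
  · simp [hh0]
  have hr : 0 < ‖h‖ := norm_pos_iff.2 hh0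
  set s := ‖h‖ / β with hs
  have hspos : 0 < s := by positivity
  have hrs : ‖h‖ = β * s := by rw [hs]; field_simp
  have hsr : s < min (min (δ / 4) (δ' / 4)) (τ * β / 4) := by
    rw [hrs, hr₀] at hh
    exact lt_of_mul_lt_mul_left hh hβ.le
  have hsδ : s < δ / 4 := hsr.trans_le ((min_le_left _ _).trans (min_le_left _ _))
  have hsδ' : s < δ' / 4 := hsr.trans_le ((min_le_left _ _).trans (min_le_right _ _))
  have hsτ : s < τ * β / 4 := hsr.trans_le (min_le_right _ _)
  have hβs : β * s ≤ s / 10 := by nlinarith only [hβ1, hspos]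
  by_contra! hbad
  set ζ := ⟪e, h⟫ with hζ
  have hζh : |ζ| ≤ ‖h‖ := by simpa [he] using abs_real_inner_le_norm e h
  have hlt : 3 * (s / β) < τ := by
    rw [← mul_div_assoc, div_lt_iff₀ hβ]
    linarith
  have hd' : ∀ u : ℝ, |u| ≤ 3 * (s / β) → |F (x + u • e) - F x - u * p| ≤ β ^ 4 / 2 * |u| :=
    fun u hu => hd u (hu.trans_lt hlt)
  have hze : ‖ζ • e‖ = |ζ| := by rw [norm_smul, he, mul_one, Real.norm_eq_abs]
  have hse : ‖s • e‖ = s := by rw [norm_smul, he, mul_one, Real.norm_of_nonneg hspos.le]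
  obtain ⟨A', B', C', hA', hB', hC', hAB, hBC⟩ := hwedge (2 * s) (by linarith) (by linarith)
    (x + ζ • e - s • e) (x + h) (x + ζ • e + s • e)
    (by
      rw [show x + ζ • e - s • e - x = ζ • e - s • e by abel]
      refine (norm_sub_le _ _).trans ?_
      linarith)
    (by rw [add_sub_cancel_left]; linarith)
    (by
      rw [show x + ζ • e + s • e - x = ζ • e + s • e by abel]
      refine (norm_add_le _ _).trans ?_
      linarith)
  have hperp : ‖h - ζ • e‖ ≤ ‖h‖ := by
    refine le_of_sq_le_sq ?_ (norm_nonneg _)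
    rw [@norm_sub_sq_real, hze, real_inner_smul_right, real_inner_comm, ← hζ, sq_abs]
    nlinarith only [sq_nonneg ζ]
  have hee : ⟪e, e⟫ = 1 := by rw [real_inner_self_eq_norm_sq, he]; norm_num
  have hperp0 : ⟪e, h - ζ • e⟫ = 0 := by
    rw [inner_sub_right, real_inner_smul_right, hee, ← hζ]; ring
  have hBdecomp : B' - (x + ζ • e) = (B' - (x + h)) + (h - ζ • e) := by abel
  have hε' : ε * ‖h‖ < |F (x + h) - F x - p * ζ| := by simpa [hζ] using hbad
  have hεs : 512 * β ^ 2 * s ≤ ε * ‖h‖ := by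
    rw [hrs]
    nlinarith only [mul_pos hβ hspos, hβε]
  have hβ3s : β ^ 3 * s ≤ β ^ 2 * s := by
    refine mul_le_mul_of_nonneg_right ?_ hspos.le
    exact pow_le_pow_of_le_one hβ.le (by linarith only [hβ1]) (by norm_num)
  have hβ4s : β ^ 4 * s ≤ β ^ 2 * s := by
    refine mul_le_mul_of_nonneg_right ?_ hspos.le
    exact pow_le_pow_of_le_one hβ.le (by linarith only [hβ1]) (by norm_num)
  obtain ⟨Q, hQ, hQS, hQx, hQp, hQinc⟩ := exists_better_dirPoint hF he hp hβ hβ1 hspos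
    (ζ := ζ) (by linarith) hd' (a := A' - (x + ζ • e - s • e)) (b := B' - (x + ζ • e))
    (c := C' - (x + ζ • e + s • e)) (by linarith) (by linarith)
    (by
      rw [hBdecomp]
      refine (norm_add_le _ _).trans ?_
      linarith)
    (by
      rw [hBdecomp, inner_add_right, hperp0, add_zero]
      refine (abs_real_inner_le_norm _ _).trans ?_
      rw [he, one_mul]
      linarith)
    (by
      rw [add_sub_cancel]
      have e1 := hF.dist_le_mul B' (x + h)
      rw [NNReal.coe_one, one_mul, Real.dist_eq, dist_eq_norm] at e1
      have e2 := hd' ζ (by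
        have : s ≤ s / β := by rw [le_div_iff₀ hβ]; nlinarith only [hβ1, hspos]
        linarith)
      have e3 : β ^ 4 / 2 * |ζ| ≤ β ^ 4 / 2 * s :=
        mul_le_mul_of_nonneg_left (by linarith) (by positivity)
      have e4 : |F (x + h) - F x - p * ζ| ≤ |F B' - F (x + ζ • e)| + |F B' - F (x + h)| +
          |F (x + ζ • e) - F x - ζ * p| := by
        have : F (x + h) - F x - p * ζ = (F B' - F (x + ζ • e)) - (F B' - F (x + h)) +
          (F (x + ζ • e) - F x - ζ * p) := by ring
        rw [this]
        refine (abs_add_le _ _).trans ?_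
        linarith [abs_sub (F B' - F (x + ζ • e)) (F B' - F (x + h))]
      have e5 : 0 ≤ β ^ 2 * s := by positivity
      linarith)
    (S := S) (by rw [add_sub_cancel, add_sub_cancel]; exact hAB)
    (by rw [add_sub_cancel, add_sub_cancel]; exact hBC)
  have hβ2 : 0 < β ^ 2 := by positivity
  exact absurd (hbest Q hQ hQS (by linarith) (by linarith) hQinc) (not_lt.2 hQp)

end Wedge

end NullSet

end

noncomputable section

namespace NullSet

/-! ### Wedges in the planar sets -/

theorem side_pos {N : ℕ → ℕ} (hgt : ∀ r, 1 < N r) (r : ℕ) : 0 < side N r := by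
  unfold side
  have : ∀ s, (0 : ℝ) < N s := fun s => by exact_mod_cast (hgt s).le.trans' (by norm_num)
  exact div_pos one_pos (Finset.prod_pos fun s _ => this s)

theorem side_eq_mul {N : ℕ → ℕ} (hgt : ∀ r, 1 < N r) (r : ℕ) :
    side N r = N r * side N (r + 1) := by
  have : (N r : ℝ) ≠ 0 := by exact_mod_cast (Nat.ne_of_gt ((hgt r).trans' one_pos))
  unfold side
  rw [Finset.prod_range_succ]
  field_simp

theorem exists_side_eq_mul {N : ℕ → ℕ} (hgt : ∀ r, 1 < N r) {s r : ℕ} (h : s ≤ r) :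
    ∃ m : ℤ, side N s = m * side N r := by
  induction r, h using Nat.le_induction with
  | base => exact ⟨1, by simp⟩
  | succ r _ ih =>
    obtain ⟨m, hm⟩ := ih
    refine ⟨m * N r, ?_⟩
    rw [hm, side_eq_mul hgt r]
    push_cast
    ring

theorem tendsto_side {N : ℕ → ℕ} (hgt : ∀ r, 1 < N r) : Tendsto (side N) atTop (𝓝 0) := by
  have hle : ∀ r, side N r ≤ (1 / 2) ^ r := by
    intro r
    induction r with
    | zero => simp [side]
    | succ r ih =>
      have h1 := side_eq_mul hgt r
      have h2 : (2 : ℝ) ≤ N r := by exact_mod_cast hgt r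
      have h3 := side_pos hgt (r + 1)
      rw [pow_succ]
      nlinarith
  exact squeeze_zero (fun r => (side_pos hgt r).le) hle
    (tendsto_pow_atTop_nhds_zero_of_lt_one (by norm_num) (by norm_num))

/-- A point at which `b x - a y` has distance at least `D ρ` from `σ (ℤ + 1/2)` lies in none of the
squares of radius `ρ` around the points of `σ ((1/2, 1/2) + ℤ²)`: as `b - a` is odd, `b x - a y` has
a value in `σ (ℤ + 1/2)` at the centre, and it varies by less than `D ρ` over the square. -/
theorem notMem_ball_of_functional {a b : ℤ} (hab : Odd (b - a)) {σ ρ v : ℝ} {D : ℝ}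
    (hD : |(a : ℝ)| + |(b : ℝ)| ≤ D) (hρ : 0 < ρ)
    (hv : ∀ w : ℤ, D * ρ ≤ |v - σ * (w + 1 / 2)|) {X : ℝ × ℝ}
    (hX : b * X.1 - a * X.2 = v) (u₁ u₂ : ℤ) :
    X ∉ Metric.ball ((σ * (1 / 2 + u₁), σ * (1 / 2 + u₂)) : ℝ × ℝ) ρ := by
  intro hmem
  rw [Metric.mem_ball, Prod.dist_eq, max_lt_iff, Real.dist_eq, Real.dist_eq] at hmem
  obtain ⟨q, hq⟩ := hab
  have hqR : (b : ℝ) - a = 2 * q + 1 := by exact_mod_cast hq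
  have h1 := hv (q + b * u₁ - a * u₂)
  have h2 : v - σ * (((q + b * u₁ - a * u₂ : ℤ) : ℝ) + 1 / 2) =
      b * (X.1 - σ * (1 / 2 + u₁)) - a * (X.2 - σ * (1 / 2 + u₂)) := by
    rw [← hX]
    push_cast
    linear_combination (σ / 2) * hqR
  rw [h2] at h1
  have h3 : |b * (X.1 - σ * (1 / 2 + u₁)) - a * (X.2 - σ * (1 / 2 + u₂))| ≤
      |(b : ℝ)| * |X.1 - σ * (1 / 2 + u₁)| + |(a : ℝ)| * |X.2 - σ * (1 / 2 + u₂)| := by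
    rw [← abs_mul, ← abs_mul]
    exact abs_sub _ _
  have hne : 0 < |(a : ℝ)| + |(b : ℝ)| := by
    by_contra! h0
    have ha : (a : ℝ) = 0 := abs_eq_zero.1 (by linarith [abs_nonneg (a : ℝ), abs_nonneg (b : ℝ)])
    have hb : (b : ℝ) = 0 := abs_eq_zero.1 (by linarith [abs_nonneg (a : ℝ), abs_nonneg (b : ℝ)])
    have ha' : a = 0 := by exact_mod_cast ha
    have hb' : b = 0 := by exact_mod_cast hb
    omega
  have h4 : |(b : ℝ)| * |X.1 - σ * (1 / 2 + u₁)| + |(a : ℝ)| * |X.2 - σ * (1 / 2 + u₂)| <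
      (|(a : ℝ)| + |(b : ℝ)|) * ρ := by
    rcases lt_or_ge 0 |(b : ℝ)| with hb | hb
    · nlinarith [abs_nonneg (a : ℝ), mul_lt_mul_of_pos_left hmem.1 hb,
        mul_le_mul_of_nonneg_left hmem.2.le (abs_nonneg (a : ℝ))]
    · have hb0 : |(b : ℝ)| = 0 := le_antisymm hb (abs_nonneg _)
      rw [hb0] at hne ⊢
      have ha : 0 < |(a : ℝ)| := by linarith
      nlinarith [mul_lt_mul_of_pos_left hmem.2 ha]
  have h5 : (|(a : ℝ)| + |(b : ℝ)|) * ρ ≤ D * ρ := mul_le_mul_of_nonneg_right hD hρ.le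
  linarith

theorem abs_int_add_half_ge (w : ℤ) : (1 : ℝ) / 2 ≤ |(w : ℝ) + 1 / 2| := by
  rcases le_or_gt 0 w with h | h
  · have : (0 : ℝ) ≤ w := by exact_mod_cast h
    rw [abs_of_nonneg (by linarith)]; linarith
  · have : (w : ℝ) ≤ -1 := by exact_mod_cast Int.le_sub_one_of_lt h
    rw [abs_of_nonpos (by linarith)]; linarith

/-- Among three equally spaced values at most one is close to `n (ℤ + 1/2)`, provided that the
spacing is larger than the width of the forbidden zones and small compared with `n`. -/
theorem eq_of_close {n v c δ : ℝ} (hc : δ ≤ |c|) (hn : 2 * |c| + δ ≤ n) {m m' : ℕ}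
    (hm : m < 3) (hm' : m' < 3) {w w' : ℤ} (h : |v + m * c - n * (w + 1 / 2)| < δ / 2)
    (h' : |v + m' * c - n * (w' + 1 / 2)| < δ / 2) : m = m' := by
  have key : ∀ {m m' : ℕ} {w w' : ℤ}, m < m' → m' < 3 → |v + m * c - n * (w + 1 / 2)| < δ / 2 →
      |v + m' * c - n * (w' + 1 / 2)| < δ / 2 → False := by
    intro m m' w w' hlt h3 h h'
    have hδ : 0 < δ := by linarith [abs_nonneg (v + m * c - n * (w + 1 / 2))]
    have hcpos : 0 < |c| := by linarith
    have hd1 : (1 : ℝ) ≤ (m' : ℝ) - m := by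
      have : (m : ℝ) + 1 ≤ m' := by exact_mod_cast hlt
      linarith
    have hd2 : (m' : ℝ) - m ≤ 2 := by
      have h1 : (m' : ℝ) ≤ 2 := by exact_mod_cast Nat.lt_succ_iff.1 h3
      have h2 : (0 : ℝ) ≤ m := Nat.cast_nonneg m
      linarith
    have e1 : |(m' - m : ℝ) * c - n * ((w' - w : ℤ) : ℝ)| < δ := by
      have : (m' - m : ℝ) * c - n * ((w' - w : ℤ) : ℝ) =
          (v + m' * c - n * (w' + 1 / 2)) - (v + m * c - n * (w + 1 / 2)) := by
        push_cast; ring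
      rw [this]
      refine (abs_sub _ _).trans_lt ?_
      linarith
    have e2 : |(m' - m : ℝ) * c| = (m' - m : ℝ) * |c| := by
      rw [abs_mul, abs_of_nonneg (by linarith : (0 : ℝ) ≤ (m' : ℝ) - m)]
    by_cases hw : w' - w = 0
    · rw [hw, Int.cast_zero, mul_zero, sub_zero, e2] at e1
      nlinarith
    · have hw1 : (1 : ℝ) ≤ |((w' - w : ℤ) : ℝ)| := by exact_mod_cast Int.one_le_abs hw
      have e3 : |n * ((w' - w : ℤ) : ℝ)| = n * |((w' - w : ℤ) : ℝ)| := by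
        rw [abs_mul, abs_of_nonneg (by linarith : 0 ≤ n)]
      have e4 := abs_sub_abs_le_abs_sub (n * ((w' - w : ℤ) : ℝ)) ((m' - m : ℝ) * c)
      rw [abs_sub_comm, e2, e3] at e4
      have e5 : n * 1 ≤ n * |((w' - w : ℤ) : ℝ)| := mul_le_mul_of_nonneg_left hw1 (by linarith)
      have e6 : (m' - m : ℝ) * |c| ≤ 2 * |c| := mul_le_mul_of_nonneg_right hd2 hcpos.le
      linarith
  rcases lt_trichotomy m m' with hlt | heq | hgt
  · exact (key hlt hm' h h').elim
  · exact heq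
  · exact (key hgt hm h' h).elim

/-- Every vector of the plane is, up to an error `1` in each coordinate, an integer vector with
coordinates of different parity. -/
theorem exists_int_approx (u v : ℝ) :
    ∃ a b : ℤ, Odd (b - a) ∧ |(a : ℝ) - u| ≤ 1 ∧ |(b : ℝ) - v| ≤ 1 := by
  refine ⟨round u, round u + 1 + 2 * round ((v - round u - 1) / 2), ?_, ?_, ?_⟩
  · exact ⟨round ((v - round u - 1) / 2), by ring⟩
  · have := abs_sub_round u
    rw [abs_sub_comm]
    linarith
  · have := abs_sub_round ((v - round u - 1) / 2)
    push_cast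
    rw [abs_le] at this ⊢
    constructor <;> linarith

/-- The line of direction `(a, b)` through a point of the grid `side N R • ℤ²` avoids the squares of
every level `r ≥ R` at which these are small enough: under `b x - a y` the grid point and the
centres have values in `side N r * ℤ` and in `side N r * (ℤ + 1/2)`, as `b - a` is odd. -/
theorem notMem_ball_of_lattice_line {N : ℕ → ℕ} (hgt : ∀ r, 1 < N r) {j : ℕ → ℝ} {R r : ℕ}
    (hRr : R ≤ r) {D : ℝ} (hj : 0 < j r) (hjN : D * j r ≤ N r) {a b : ℤ} (hab : Odd (b - a))
    (hD : |(a : ℝ)| + |(b : ℝ)| ≤ D) {k l : ℤ} {X : ℝ × ℝ}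
    (hX : b * X.1 - a * X.2 = side N R * (b * k - a * l)) {c : ℝ × ℝ} (hc : c ∈ lattice N r) :
    X ∉ Metric.ball c (1 / 2 * j r * side N (r + 1)) := by
  obtain ⟨u₁, u₂, rfl⟩ := hc
  obtain ⟨m, hm⟩ := exists_side_eq_mul hgt hRr
  have hpos := side_pos hgt (r + 1)
  have hposr := side_pos hgt r
  refine notMem_ball_of_functional hab hD (by positivity) (fun w => ?_) hX u₁ u₂
  have h1 := abs_int_add_half_ge (m * (b * k - a * l) - w - 1)
  have h2 : side N R * (b * k - a * l) - side N r * (w + 1 / 2) =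
      side N r * (((m * (b * k - a * l) - w - 1 : ℤ) : ℝ) + 1 / 2) := by
    rw [hm]; push_cast; ring
  rw [h2, abs_mul, abs_of_pos hposr]
  have h3 : D * (1 / 2 * j r * side N (r + 1)) ≤ side N r * (1 / 2) := by
    rw [side_eq_mul hgt r]
    nlinarith
  nlinarith

/-- At the critical level, the lines through `(k, l)` in the two directions may hit a square, but
one of three equally spaced points `(k, l) + d (1, 1)` on a diagonal is good for both directions:
each direction excludes at most one of them. -/
theorem exists_good_candidate {n J D : ℝ} (hJ : 1 ≤ J) (hD : 1 ≤ D) (hn : 5 * D ^ 2 * J ≤ n)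
    {a₁ b₁ a₂ b₂ : ℤ} (h₁ : Odd (b₁ - a₁)) (h₂ : Odd (b₂ - a₂)) (hD₁ : |(a₁ : ℝ)| + |(b₁ : ℝ)| ≤ D)
    (hD₂ : |(a₂ : ℝ)| + |(b₂ : ℝ)| ≤ D) (k l : ℤ) :
    ∃ d : ℤ, |(d : ℝ)| ≤ 4 * (J * D) ∧
      (∀ w : ℤ, D * J / 2 ≤ |b₁ * ((k + d : ℤ) : ℝ) - a₁ * ((l + d : ℤ) : ℝ) - n * (w + 1 / 2)|) ∧
      ∀ w : ℤ, D * J / 2 ≤ |b₂ * ((k + d : ℤ) : ℝ) - a₂ * ((l + d : ℤ) : ℝ) - n * (w + 1 / 2)| := by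
  -- the spacing `T (b - a)` of the three values is at least the width `D J` of the forbidden zones
  set T : ℤ := ⌈D * J⌉ with hT
  have hDJ : 1 ≤ D * J := by nlinarith
  have hT1 : D * J ≤ T := Int.le_ceil _
  have hT2 : (T : ℝ) ≤ 2 * (D * J) := by linarith [Int.ceil_lt_add_one (D * J)]
  have hodd : ∀ {a b : ℤ}, Odd (b - a) → |(a : ℝ)| + |(b : ℝ)| ≤ D →
      D * J ≤ |(T : ℝ) * (b - a)| ∧ 2 * |(T : ℝ) * (b - a)| + D * J ≤ n := by
    intro a b hab hDab
    have hT0 : (0 : ℝ) ≤ T := by linarith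
    have h1 : (1 : ℝ) ≤ |(b : ℝ) - a| := by
      have : b - a ≠ 0 := by rintro h; rw [h] at hab; simp at hab
      exact_mod_cast Int.one_le_abs this
    have h2 : |(b : ℝ) - a| ≤ D := (abs_sub _ _).trans (by linarith)
    rw [abs_mul, abs_of_nonneg hT0]
    constructor
    · nlinarith
    · have h3 : (T : ℝ) * |(b : ℝ) - a| ≤ 2 * (D * J) * D :=
        mul_le_mul hT2 h2 (abs_nonneg _) (by positivity)
      nlinarith
  have hval : ∀ (a b : ℤ) (m : ℕ), (b : ℝ) * ((k + m * T : ℤ) : ℝ) - a * ((l + m * T : ℤ) : ℝ) =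
      (b * k - a * l) + m * (T * (b - a)) := by
    intro a b m; push_cast; ring
  by_contra! hcon
  have hbad : ∀ m : ℕ, m < 3 →
      (∃ w : ℤ, |(b₁ * k - a₁ * l : ℝ) + m * (T * (b₁ - a₁)) - n * (w + 1 / 2)| < D * J / 2) ∨
      (∃ w : ℤ, |(b₂ * k - a₂ * l : ℝ) + m * (T * (b₂ - a₂)) - n * (w + 1 / 2)| < D * J / 2) := by
    intro m hm
    have hd : |((m * T : ℤ) : ℝ)| ≤ 4 * (J * D) := by
      have hm2 : (m : ℝ) ≤ 2 := by exact_mod_cast Nat.lt_succ_iff.1 hm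
      have hm0 : (0 : ℝ) ≤ m := Nat.cast_nonneg m
      push_cast
      rw [abs_of_nonneg (by nlinarith)]
      nlinarith
    by_cases hA : ∀ w : ℤ, D * J / 2 ≤
        |b₁ * ((k + m * T : ℤ) : ℝ) - a₁ * ((l + m * T : ℤ) : ℝ) - n * (w + 1 / 2)|
    · obtain ⟨w, hw⟩ := hcon _ hd hA
      exact Or.inr ⟨w, by rwa [← hval]⟩
    · push Not at hA
      obtain ⟨w, hw⟩ := hA
      exact Or.inl ⟨w, by rwa [← hval]⟩
  have hu₁ : ∀ {m m' : ℕ} {w w' : ℤ}, m < 3 → m' < 3 → m ≠ m' →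
      |(b₁ * k - a₁ * l : ℝ) + m * (T * (b₁ - a₁)) - n * (w + 1 / 2)| < D * J / 2 →
      |(b₁ * k - a₁ * l : ℝ) + m' * (T * (b₁ - a₁)) - n * (w' + 1 / 2)| < D * J / 2 → False :=
    fun hm hm' hne h h' => hne (eq_of_close (hodd h₁ hD₁).1 (hodd h₁ hD₁).2 hm hm' h h')
  have hu₂ : ∀ {m m' : ℕ} {w w' : ℤ}, m < 3 → m' < 3 → m ≠ m' →
      |(b₂ * k - a₂ * l : ℝ) + m * (T * (b₂ - a₂)) - n * (w + 1 / 2)| < D * J / 2 →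
      |(b₂ * k - a₂ * l : ℝ) + m' * (T * (b₂ - a₂)) - n * (w' + 1 / 2)| < D * J / 2 → False :=
    fun hm hm' hne h h' => hne (eq_of_close (hodd h₂ hD₂).1 (hodd h₂ hD₂).2 hm hm' h h')
  rcases hbad 0 (by norm_num) with ⟨w0, c0⟩ | ⟨w0, c0⟩ <;>
  rcases hbad 1 (by norm_num) with ⟨w1, c1⟩ | ⟨w1, c1⟩ <;>
  rcases hbad 2 (by norm_num) with ⟨w2, c2⟩ | ⟨w2, c2⟩ <;>
  first
  | exact hu₁ (by norm_num) (by norm_num) (by norm_num) c0 c1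
  | exact hu₁ (by norm_num) (by norm_num) (by norm_num) c0 c2
  | exact hu₁ (by norm_num) (by norm_num) (by norm_num) c1 c2
  | exact hu₂ (by norm_num) (by norm_num) (by norm_num) c0 c1
  | exact hu₂ (by norm_num) (by norm_num) (by norm_num) c0 c2
  | exact hu₂ (by norm_num) (by norm_num) (by norm_num) c1 c2

end NullSet

end

noncomputable section

namespace NullSet

theorem mem_planeSet_iff {N : ℕ → ℕ} {i : ℕ → ℝ} {X : ℝ × ℝ} :
    X ∈ planeSet N i ↔
      ∀ r, ∀ c ∈ lattice N r, X ∉ Metric.ball c (1 / 2 * i r * side N (r + 1)) := by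
  simp [planeSet]

/-- Near a point of `W_i`, any two segments with a common end point are approximated, on every
small scale `ρ`, by segments in `W_j`, when `i ≺ j`. The squares of the early levels stay away
because those for `j` are smaller than those for `i`. At the first level `R` for which this fails,
the squares for `j` are much smaller than `ρ`, hence so is the grid `side N (R + 1) • ℤ²`. The
segments start at a point of this grid and have directions from a finite set that does not depend
on the scale. -/
theorem exists_wedge_planeSet {N : ℕ → ℕ} (hgt : ∀ r, 1 < N r) {i j : ℕ → ℝ}
    (hj : ∀ r, 1 ≤ j r) (hij : Prec i j) (hiN : ∀ r, i r < N r)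
    (hjN : Tendsto (fun r => j r / (N r : ℝ)) atTop (𝓝 0)) {η : ℝ} (hη : 0 < η) (hη1 : η ≤ 1) :
    ∃ δ > 0, ∀ ρ, 0 < ρ → ρ < δ → ∀ x ∈ planeSet N i, ∀ A B C : ℝ × ℝ,
      dist A x ≤ ρ → dist B x ≤ ρ → dist C x ≤ ρ →
      ∃ A' B' C' : ℝ × ℝ, dist A' A ≤ η * ρ ∧ dist B' B ≤ η * ρ ∧ dist C' C ≤ η * ρ ∧
        segment ℝ A' B' ⊆ planeSet N j ∧ segment ℝ B' C' ⊆ planeSet N j := by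
  obtain ⟨Q, hQ⟩ := exists_nat_ge (2 / η)
  have hQ0 : (0 : ℝ) < Q := lt_of_lt_of_le (by positivity) hQ
  have hQη : 1 / (Q : ℝ) ≤ η / 2 := by
    rw [div_le_iff₀ hη] at hQ
    rw [div_le_iff₀ hQ0]
    linarith
  set D : ℝ := 4 * Q + 2 with hD
  have hD1 : 1 ≤ D := by linarith
  have hNpos : ∀ r, (0 : ℝ) < N r := fun r => by exact_mod_cast (hgt r).trans' one_pos
  have ev1 : ∀ᶠ r in atTop, 5 * D ^ 2 * j r ≤ N r := by
    filter_upwards [hjN.eventually (gt_mem_nhds (show 0 < 1 / (5 * D ^ 2) by positivity))]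
      with r hr
    rw [div_lt_div_iff₀ (hNpos r) (by positivity)] at hr
    linarith
  have ev2 : ∀ᶠ r in atTop, (1 + 40 * D / η) * j r ≤ i r := by
    filter_upwards [hij.2.eventually_ge_atTop (1 + 40 * D / η)] with r hr
    rwa [le_div_iff₀ (by linarith [hj r])] at hr
  obtain ⟨r₀, hr₀⟩ := eventually_atTop.1 (ev1.and ev2)
  set c : ℕ → ℝ := fun r => (i r - j r) / 2 * side N (r + 1) with hc
  have hcpos : ∀ r, 0 < c r := fun r =>
    mul_pos (by linarith [hij.1 r]) (side_pos hgt (r + 1))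
  have hcle : ∀ r, c r ≤ side N r := by
    intro r
    rw [side_eq_mul hgt r]
    refine mul_le_mul_of_nonneg_right ?_ (side_pos hgt _).le
    linarith [hiN r, hj r, hNpos r]
  have ev3 : ∀ᶠ δ in 𝓝[>] (0 : ℝ), ∀ r ∈ Finset.range r₀, 2 * δ < c r := by
    rw [Filter.eventually_all_finset]
    intro r _
    have : Tendsto (fun δ : ℝ => 2 * δ) (𝓝[>] 0) (𝓝 0) := by
      simpa using ((continuous_const_mul (2 : ℝ)).tendsto 0).mono_left nhdsWithin_le_nhds
    exact this.eventually (gt_mem_nhds (hcpos r))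
  obtain ⟨δ, hδ, hδpos⟩ := (ev3.and self_mem_nhdsWithin).exists
  refine ⟨δ, hδpos, fun ρ hρ hρδ x hx A B C hA hB hC => ?_⟩
  -- the critical level
  have hex : ∃ r, r₀ ≤ r ∧ c r ≤ 2 * ρ := by
    have h1 := (tendsto_side hgt).eventually (gt_mem_nhds (show 0 < 2 * ρ by positivity))
    obtain ⟨r, hr1, hr2⟩ := (h1.and (eventually_ge_atTop r₀)).exists
    exact ⟨r, hr2, (hcle r).trans hr1.le⟩
  classical
  set R := Nat.find hex with hR
  obtain ⟨hRr₀, hcR⟩ := Nat.find_spec hex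
  rw [← hR] at hRr₀ hcR
  have hearly : ∀ r < R, 2 * ρ < c r := by
    intro r hr
    by_cases h : r < r₀
    · have := hδ r (Finset.mem_range.2 h)
      linarith
    · have := Nat.find_min hex hr
      push Not at this
      exact this (not_lt.1 h)
  set σ := side N (R + 1) with hσ
  have hσpos : 0 < σ := side_pos hgt _
  set J := j R with hJ
  have hJ1 : 1 ≤ J := hj R
  have hJσ : 5 * (J * D) * σ ≤ η * ρ / 2 := by
    have h1 := (hr₀ R hRr₀).2
    have h2 : (40 * D / η) * J * σ / 2 ≤ 2 * ρ := by
      refine le_trans ?_ hcR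
      have h4 : 40 * D / η * J ≤ i R - j R := by linarith
      have h5 := mul_le_mul_of_nonneg_right h4 hσpos.le
      change _ ≤ (i R - j R) / 2 * σ
      linarith
    have h3 : (40 * D / η) * J * σ / 2 = 20 * (J * D) * σ / η := by ring
    rw [h3, div_le_iff₀ hη] at h2
    linarith
  -- integer directions on the scale `ρ / Q`, which depend on `A`, `B`, `C` but are bounded by `D`
  have hround : ∀ Y : ℝ × ℝ, dist Y x ≤ ρ → ∃ a b : ℤ, Odd (b - a) ∧
      |(a : ℝ)| + |(b : ℝ)| ≤ D ∧ |ρ / Q * a - (Y.1 - B.1)| ≤ η * ρ / 2 ∧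
      |ρ / Q * b - (Y.2 - B.2)| ≤ η * ρ / 2 := by
    intro Y hY
    have hYB : dist Y B ≤ 2 * ρ := by linarith [dist_triangle_right Y B x]
    rw [Prod.dist_eq, max_le_iff, Real.dist_eq, Real.dist_eq] at hYB
    obtain ⟨a, b, hab, ha, hb⟩ := exists_int_approx (Q / ρ * (Y.1 - B.1)) (Q / ρ * (Y.2 - B.2))
    have hbound : ∀ {u : ℝ} {z : ℤ}, |u| ≤ 2 * ρ → |(z : ℝ) - Q / ρ * u| ≤ 1 →
        |(z : ℝ)| ≤ 2 * Q + 1 ∧ |ρ / Q * z - u| ≤ η * ρ / 2 := by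
      intro u z hu hz
      constructor
      · have h1 : |Q / ρ * u| ≤ 2 * Q := by
          rw [abs_mul, abs_of_pos (by positivity)]
          calc Q / ρ * |u| ≤ Q / ρ * (2 * ρ) := by gcongr
            _ = 2 * Q := by field_simp
        have h2 := abs_sub_abs_le_abs_sub (z : ℝ) (Q / ρ * u)
        linarith
      · have h1 : ρ / Q * z - u = ρ / Q * (z - Q / ρ * u) := by field_simp
        rw [h1, abs_mul, abs_of_pos (by positivity)]
        calc ρ / Q * |(z : ℝ) - Q / ρ * u| ≤ ρ / Q * 1 := by gcongr
          _ = 1 / Q * ρ := by ring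
          _ ≤ η / 2 * ρ := by gcongr
          _ = _ := by ring
    obtain ⟨ha1, ha2⟩ := hbound hYB.1 ha
    obtain ⟨hb1, hb2⟩ := hbound hYB.2 hb
    exact ⟨a, b, hab, by linarith, ha2, hb2⟩
  obtain ⟨a₁, b₁, hodd₁, hD₁, ha₁, hb₁⟩ := hround A hA
  obtain ⟨a₂, b₂, hodd₂, hD₂, ha₂, hb₂⟩ := hround C hC
  -- the common end point
  obtain ⟨d, hd, hgood₁, hgood₂⟩ := exists_good_candidate hJ1 hD1 (hr₀ R hRr₀).1 hodd₁ hodd₂ hD₁ hD₂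
    (round (B.1 / σ)) (round (B.2 / σ))
  set k : ℤ := round (B.1 / σ) + d with hk
  set l : ℤ := round (B.2 / σ) + d with hl
  have hgrid : ∀ y : ℝ, |σ * ((round (y / σ) + d : ℤ) : ℝ) - y| ≤ η * ρ / 2 := by
    intro y
    have h1 := abs_sub_round (y / σ)
    have h2 : σ * ((round (y / σ) + d : ℤ) : ℝ) - y = σ * (d - (y / σ - round (y / σ))) := by
      push_cast; field_simp; ring
    have h3 : |(d : ℝ) - (y / σ - round (y / σ))| ≤ 5 * (J * D) := by
      refine (abs_sub _ _).trans ?_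
      nlinarith
    rw [h2, abs_mul, abs_of_pos hσpos]
    nlinarith
  set B' : ℝ × ℝ := (σ * k, σ * l) with hB'
  have hB'B : |σ * k - B.1| ≤ η * ρ / 2 ∧ |σ * l - B.2| ≤ η * ρ / 2 := ⟨hgrid _, hgrid _⟩
  have hdist : ∀ {Y : ℝ × ℝ} {a b : ℤ}, |ρ / Q * a - (Y.1 - B.1)| ≤ η * ρ / 2 →
      |ρ / Q * b - (Y.2 - B.2)| ≤ η * ρ / 2 →
      dist ((σ * k + ρ / Q * a, σ * l + ρ / Q * b) : ℝ × ℝ) Y ≤ η * ρ := by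
    intro Y a b h1 h2
    rw [Prod.dist_eq, max_le_iff, Real.dist_eq, Real.dist_eq]
    have h3 := hB'B.1
    have h4 := hB'B.2
    rw [abs_le] at h1 h2 h3 h4
    constructor
    · rw [abs_le]; constructor <;> dsimp only <;> linarith [h1.1, h1.2, h3.1, h3.2]
    · rw [abs_le]; constructor <;> dsimp only <;> linarith [h2.1, h2.2, h4.1, h4.2]
  have hηρ : η * ρ ≤ ρ := mul_le_of_le_one_left hρ.le hη1
  have hB'dist : dist B' B ≤ η * ρ := by
    rw [Prod.dist_eq, max_le_iff, Real.dist_eq, Real.dist_eq]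
    have : 0 ≤ η * ρ := by positivity
    exact ⟨hB'B.1.trans (by linarith), hB'B.2.trans (by linarith)⟩
  -- points of the two lines near `x` avoid all squares
  have havoid : ∀ {a b : ℤ}, Odd (b - a) → |(a : ℝ)| + |(b : ℝ)| ≤ D →
      (∀ w : ℤ, D * J / 2 ≤ |b * (k : ℝ) - a * (l : ℝ) - N R * (w + 1 / 2)|) →
      ∀ X : ℝ × ℝ, b * X.1 - a * X.2 = σ * (b * k - a * l) → dist X x ≤ 2 * ρ →
        X ∈ planeSet N j := by
    intro a b hab hDab hgood X hX hXx
    rw [mem_planeSet_iff]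
    intro r y hy
    rcases lt_trichotomy r R with hr | hr | hr
    · intro hXy
      refine mem_planeSet_iff.1 hx r y hy ?_
      rw [Metric.mem_ball] at hXy ⊢
      have h1 := hearly r hr
      have h2 : c r = 1 / 2 * i r * side N (r + 1) - 1 / 2 * j r * side N (r + 1) := by
        simp only [hc]; ring
      have h3 := dist_triangle_left x y X
      linarith
    · subst hr
      obtain ⟨u₁, u₂, rfl⟩ := hy
      refine notMem_ball_of_functional hab hDab (by positivity) (fun w => ?_) hX u₁ u₂
      have h1 : σ * (b * k - a * l) - side N R * (w + 1 / 2) =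
          σ * (b * (k : ℝ) - a * (l : ℝ) - N R * (w + 1 / 2)) := by
        rw [side_eq_mul hgt R]; ring
      rw [h1, abs_mul, abs_of_pos hσpos]
      have h2 := mul_le_mul_of_nonneg_left (hgood w) hσpos.le
      refine le_trans (le_of_eq ?_) h2
      ring
    · refine notMem_ball_of_lattice_line hgt (Nat.succ_le_of_lt hr) (by linarith [hj r]) ?_ hab hDab
        hX hy
      have h1 := (hr₀ r (hRr₀.trans hr.le)).1
      have h2 := hj r
      have h3 : D * j r ≤ 5 * D ^ 2 * j r := by
        refine mul_le_mul_of_nonneg_right ?_ (by linarith)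
        nlinarith
      linarith
  have hsegment : ∀ {a b : ℤ} {Y : ℝ × ℝ}, dist Y x ≤ ρ → Odd (b - a) →
      |(a : ℝ)| + |(b : ℝ)| ≤ D → |ρ / Q * a - (Y.1 - B.1)| ≤ η * ρ / 2 →
      |ρ / Q * b - (Y.2 - B.2)| ≤ η * ρ / 2 →
      (∀ w : ℤ, D * J / 2 ≤ |b * (k : ℝ) - a * (l : ℝ) - N R * (w + 1 / 2)|) →
      segment ℝ B' (σ * k + ρ / Q * a, σ * l + ρ / Q * b) ⊆ planeSet N j := by
    intro a b Y hY hab hDab h1 h2 hgood X hX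
    refine havoid hab hDab hgood X ?_ ?_
    · rw [segment_eq_image'] at hX
      obtain ⟨θ, -, rfl⟩ := hX
      simp only [hB', Prod.fst_add, Prod.snd_add, Prod.smul_fst, Prod.smul_snd, Prod.fst_sub,
        Prod.snd_sub, smul_eq_mul]
      ring
    · have h3 := hdist h1 h2
      refine (convex_closedBall x (2 * ρ)).segment_subset ?_ ?_ hX
      · rw [Metric.mem_closedBall]
        linarith [dist_triangle B' B x]
      · rw [Metric.mem_closedBall]
        linarith [dist_triangle ((σ * k + ρ / Q * a, σ * l + ρ / Q * b) : ℝ × ℝ) Y x]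
  refine ⟨_, B', _, hdist ha₁ hb₁, hB'dist, hdist ha₂ hb₂, ?_,
    hsegment hC hodd₂ hD₂ ha₂ hb₂ hgood₂⟩
  rw [segment_symm]
  exact hsegment hA hodd₁ hD₁ ha₁ hb₁ hgood₁

/-! ### The sets in Euclidean space -/

/-- The projection of `ℝ^n` to its first two coordinates. -/
def planeProj {n : ℕ} (hn : 2 ≤ n) : EuclideanSpace ℝ (Fin n) →L[ℝ] ℝ × ℝ :=
  (EuclideanSpace.proj ⟨0, by omega⟩).prod (EuclideanSpace.proj ⟨1, by omega⟩)

theorem mem_spaceSet_iff {N : ℕ → ℕ} {n : ℕ} (hn : 2 ≤ n) {i : ℕ → ℝ}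
    {x : EuclideanSpace ℝ (Fin n)} : x ∈ spaceSet N hn i ↔ planeProj hn x ∈ planeSet N i :=
  Iff.rfl

theorem dist_planeProj_le {n : ℕ} (hn : 2 ≤ n) (x y : EuclideanSpace ℝ (Fin n)) :
    dist (planeProj hn x) (planeProj hn y) ≤ ‖x - y‖ := by
  rw [Prod.dist_eq, max_le_iff, Real.dist_eq, Real.dist_eq]
  exact ⟨PiLp.norm_apply_le (x - y) _, PiLp.norm_apply_le (x - y) _⟩

theorem exists_lift_planeProj {n : ℕ} (hn : 2 ≤ n) (A : EuclideanSpace ℝ (Fin n)) (P : ℝ × ℝ) :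
    ∃ A' : EuclideanSpace ℝ (Fin n), planeProj hn A' = P ∧
      ‖A' - A‖ ≤ 2 * dist P (planeProj hn A) := by
  set i₀ : Fin n := ⟨0, by omega⟩ with hi₀
  set i₁ : Fin n := ⟨1, by omega⟩ with hi₁
  have hne : i₀ ≠ i₁ := by simp [hi₀, hi₁]
  refine ⟨A + (EuclideanSpace.single i₀ (P.1 - A i₀) + EuclideanSpace.single i₁ (P.2 - A i₁)),
    ?_, ?_⟩
  · ext
    · change (A + (EuclideanSpace.single i₀ (P.1 - A i₀) +
        EuclideanSpace.single i₁ (P.2 - A i₁))) i₀ = P.1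
      simp [hne]
    · change (A + (EuclideanSpace.single i₀ (P.1 - A i₀) +
        EuclideanSpace.single i₁ (P.2 - A i₁))) i₁ = P.2
      simp [hne.symm]
  · rw [add_sub_cancel_left]
    refine (norm_add_le _ _).trans ?_
    rw [PiLp.norm_single, PiLp.norm_single, two_mul]
    exact add_le_add (le_max_left (dist P.1 (A i₀)) (dist P.2 (A i₁)))
      (le_max_right (dist P.1 (A i₀)) (dist P.2 (A i₁)))

theorem wedgeApprox_spaceSet {N : ℕ → ℕ} (hgt : ∀ r, 1 < N r) {n : ℕ} (hn : 2 ≤ n) {i j : ℕ → ℝ}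
    (hi : i ∈ Index N) (hj : j ∈ Index N) (hij : Prec i j) {x : EuclideanSpace ℝ (Fin n)}
    (hx : x ∈ spaceSet N hn i) : WedgeApprox (spaceSet N hn j) x := by
  intro η hη
  obtain ⟨δ, hδ, h⟩ := exists_wedge_planeSet hgt (fun r => (hj.1 r).1) hij
    (fun r => (hi.1 r).2) hj.2 (η := min (η / 2) 1) (lt_min (by positivity) one_pos)
    (min_le_right _ _)
  refine ⟨δ, hδ, fun r hr hrδ A B C hA hB hC => ?_⟩
  obtain ⟨A', B', C', hA', hB', hC', hAB, hBC⟩ := h r hr hrδ _ ((mem_spaceSet_iff hn).1 hx)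
    (planeProj hn A) (planeProj hn B) (planeProj hn C) ((dist_planeProj_le hn _ _).trans hA)
    ((dist_planeProj_le hn _ _).trans hB) ((dist_planeProj_le hn _ _).trans hC)
  have hle : min (η / 2) 1 * r ≤ η / 2 * r :=
    mul_le_mul_of_nonneg_right (min_le_left _ _) hr.le
  obtain ⟨A₁, hA₁, hA₁d⟩ := exists_lift_planeProj hn A A'
  obtain ⟨B₁, hB₁, hB₁d⟩ := exists_lift_planeProj hn B B'
  obtain ⟨C₁, hC₁, hC₁d⟩ := exists_lift_planeProj hn C C'
  have hseg : ∀ {U V : EuclideanSpace ℝ (Fin n)} {U' V' : ℝ × ℝ}, planeProj hn U = U' →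
      planeProj hn V = V' → segment ℝ U' V' ⊆ planeSet N j →
      segment ℝ U V ⊆ spaceSet N hn j := by
    rintro U V _ _ rfl rfl hUV X hX
    refine (mem_spaceSet_iff hn).2 (hUV ?_)
    obtain ⟨p, q, hp, hq, hpq, rfl⟩ := hX
    exact ⟨p, q, hp, hq, hpq, by simp⟩
  exact ⟨A₁, B₁, C₁, by linarith, by linarith, by linarith, hseg hA₁ hB₁ hAB, hseg hB₁ hC₁ hBC⟩

theorem isClosed_spaceSet (N : ℕ → ℕ) {n : ℕ} (hn : 2 ≤ n) (i : ℕ → ℝ) :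
    IsClosed (spaceSet N hn i) := by
  have h : IsClosed (planeSet N i) :=
    (isOpen_iUnion fun r => isOpen_biUnion fun c _ => Metric.isOpen_ball).isClosed_compl
  exact h.preimage (planeProj hn).continuous

theorem spaceSet_mono {N : ℕ → ℕ} (hgt : ∀ r, 1 < N r) {n : ℕ} (hn : 2 ≤ n) {i j : ℕ → ℝ}
    (hij : ∀ r, j r ≤ i r) : spaceSet N hn i ⊆ spaceSet N hn j := by
  intro x hx
  rw [mem_spaceSet_iff, mem_planeSet_iff] at hx ⊢
  intro r c hc hmem
  refine hx r c hc (Metric.ball_subset_ball ?_ hmem)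
  have := side_pos hgt (r + 1)
  have := hij r
  gcongr

/-- The geometric interpolation `k ^ (1 - t) * l ^ t` between two indices. -/
def interp (k l : ℕ → ℝ) (t : ℝ) (r : ℕ) : ℝ := l r * (k r / l r) ^ (1 - t)

section Interp

variable {N : ℕ → ℕ} {k l : ℕ → ℝ}

theorem interp_zero (hl : ∀ r, 1 ≤ l r) : interp k l 0 = k := by
  ext r
  have : l r ≠ 0 := by linarith [hl r]
  simp only [interp, sub_zero, Real.rpow_one]
  field_simp

theorem interp_one : interp k l 1 = l := by
  ext r
  simp [interp]

theorem one_lt_div_of_prec (hl : ∀ r, 1 ≤ l r) (hkl : Prec k l) (r : ℕ) : 1 < k r / l r := by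
  rw [one_lt_div (by linarith [hl r])]
  exact hkl.1 r

theorem interp_anti (hl : ∀ r, 1 ≤ l r) (hkl : Prec k l) {s t : ℝ} (hst : s ≤ t) (r : ℕ) :
    interp k l t r ≤ interp k l s r := by
  unfold interp
  have h1 := one_lt_div_of_prec hl hkl r
  have h2 := hl r
  gcongr
  exact h1.le

theorem prec_interp (hl : ∀ r, 1 ≤ l r) (hkl : Prec k l) {s t : ℝ} (hst : s < t) :
    Prec (interp k l s) (interp k l t) := by
  constructor
  · intro r
    unfold interp
    have h1 := one_lt_div_of_prec hl hkl r
    have h2 := hl r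
    refine mul_lt_mul_of_pos_left (Real.rpow_lt_rpow_of_exponent_lt h1 ?_) ?_ <;> linarith
  · have h1 : (fun r => interp k l s r / interp k l t r) = fun r => (k r / l r) ^ (t - s) := by
      ext r
      have h1 : 0 < k r / l r := one_pos.trans (one_lt_div_of_prec hl hkl r)
      have h2 : l r ≠ 0 := by linarith [hl r]
      unfold interp
      rw [mul_div_mul_left _ _ h2, ← Real.rpow_sub h1]
      congr 1
      ring
    rw [h1]
    exact (tendsto_rpow_atTop (sub_pos.2 hst)).comp hkl.2

theorem interp_mem_index (hgt : ∀ r, 1 < N r) (hk : k ∈ Index N) (hl : l ∈ Index N)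
    (hkl : Prec k l) {t : ℝ} (h0 : 0 ≤ t) (h1 : t ≤ 1) : interp k l t ∈ Index N := by
  have hl1 : ∀ r, 1 ≤ l r := fun r => (hl.1 r).1
  have hlow : ∀ r, l r ≤ interp k l t r := fun r => by
    simpa [interp_one] using interp_anti hl1 hkl h1 r
  have hupp : ∀ r, interp k l t r ≤ k r := fun r => by
    simpa [interp_zero hl1] using interp_anti hl1 hkl h0 r
  have hN : ∀ r, (0 : ℝ) < N r := fun r => by exact_mod_cast (hgt r).trans' one_pos
  refine ⟨fun r => ⟨(hl1 r).trans (hlow r), (hupp r).trans_lt (hk.1 r).2⟩, ?_⟩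
  refine squeeze_zero (fun r => ?_) (fun r => ?_) hk.2
  · exact div_nonneg (by linarith [hl1 r, hlow r]) (hN r).le
  · exact div_le_div_of_nonneg_right (hupp r) (hN r).le

end Interp

end NullSet

end

noncomputable section

namespace NullSet

open scoped RealInnerProductSpace

/-! ### Points of differentiability -/

section Final

variable {E : Type*} [NormedAddCommGroup E] [InnerProductSpace ℝ E]

/-- On a nondegenerate segment a Lipschitz function has a derivative along the segment at some
point. -/
theorem exists_admissible_mem_segment {f : E → ℝ} (hf : LipschitzWith 1 f) {A B : E}
    (hAB : A ≠ B) : ∃ P : DirPoint E, P.Admissible f ∧ P.pt ∈ segment ℝ A B := by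
  have hlip : LipschitzWith (1 * ‖B - A‖₊) fun t : ℝ => f (A + t • (B - A)) := by
    refine hf.comp (LipschitzWith.of_dist_le_mul fun t u => ?_)
    rw [dist_add_left, dist_eq_norm, ← sub_smul, norm_smul, mul_comm, Real.dist_eq,
      Real.norm_eq_abs, coe_nnnorm]
  have hdiff := hlip.ae_differentiableAt_real
  obtain ⟨τ, hτ, hτd⟩ : ∃ τ ∈ Set.Ioo (0 : ℝ) 1,
      DifferentiableAt ℝ (fun t : ℝ => f (A + t • (B - A))) τ := by
    by_contra! hcon
    have h1 : MeasureTheory.volume (Set.Ioo (0 : ℝ) 1) = 0 :=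
      MeasureTheory.measure_mono_null (fun t ht => hcon t ht) hdiff
    simp at h1
  have hpos : 0 < ‖B - A‖ := norm_pos_iff.2 (sub_ne_zero.2 hAB.symm)
  have hline : HasLineDerivAt ℝ f (deriv (fun t : ℝ => f (A + t • (B - A))) τ)
      (A + τ • (B - A)) (B - A) := by
    have h1 : HasDerivAt (fun t : ℝ => f (A + (τ + t) • (B - A)))
        (deriv (fun t : ℝ => f (A + t • (B - A))) τ) 0 :=
      HasDerivAt.comp_const_add (f := fun t : ℝ => f (A + t • (B - A))) τ 0
        (by rw [add_zero]; exact hτd.hasDerivAt)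
    refine h1.congr_of_eventuallyEq (Eventually.of_forall fun t => ?_)
    simp only [add_smul, add_assoc]
  refine ⟨⟨A + τ • (B - A), ‖B - A‖⁻¹ • (B - A), _⟩, ⟨?_, hline.smul ‖B - A‖⁻¹⟩, ?_⟩
  · change ‖‖B - A‖⁻¹ • (B - A)‖ = 1
    rw [norm_smul, norm_inv, norm_norm, inv_mul_cancel₀ hpos.ne']
  · rw [segment_eq_image']
    exact ⟨τ, ⟨hτ.1.le, hτ.2.le⟩, rfl⟩

/-- The starting pair for the search: it lies on a short segment in `S`. -/
theorem WedgeApprox.exists_admissible {f : E → ℝ} (hf : LipschitzWith 1 f) [Nontrivial E]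
    {S : Set E} {y : E} (hS : WedgeApprox S y) {d : ℝ} (hd : 0 < d) :
    ∃ P : DirPoint E, P.Admissible f ∧ P.pt ∈ S ∧ ‖P.pt - y‖ < d := by
  obtain ⟨δ, hδ, h⟩ := hS (1 / 4) (by norm_num)
  set r := min (δ / 2) (d / 4) with hr
  have hr0 : 0 < r := by positivity
  have hrδ : r < δ := by linarith [min_le_left (δ / 2) (d / 4)]
  have hrd : r ≤ d / 4 := min_le_right _ _
  obtain ⟨e, he⟩ := exists_norm_eq E zero_le_one
  have hre : ‖r • e‖ = r := by rw [norm_smul, he, mul_one, Real.norm_of_nonneg hr0.le]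
  obtain ⟨A', B', -, hA', hB', -, hAB, -⟩ := h r hr0 hrδ y (y + r • e) y (by simpa using hr0.le)
    (by rw [add_sub_cancel_left, hre]) (by simpa using hr0.le)
  have hne : A' ≠ B' := by
    rintro rfl
    have h1 : r • e = (A' - y) - (A' - (y + r • e)) := by abel
    have h2 := norm_sub_le (A' - y) (A' - (y + r • e))
    rw [← h1, hre] at h2
    linarith
  obtain ⟨P, hP, hPseg⟩ := exists_admissible_mem_segment hf hne
  refine ⟨P, hP, hAB hPseg, ?_⟩
  have hsub : segment ℝ A' B' ⊆ Metric.closedBall y (2 * r) := by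
    refine (convex_closedBall y (2 * r)).segment_subset ?_ ?_
    · rw [mem_closedBall_iff_norm]; linarith
    · rw [mem_closedBall_iff_norm]
      have := norm_sub_le_norm_sub_add_norm_sub B' (y + r • e) y
      rw [add_sub_cancel_left, hre] at this
      linarith
  have := mem_closedBall_iff_norm.1 (hsub hPseg)
  linarith

/-- An increasing family of closed sets, each of which is rich in wedges near the points of the
smaller ones, contains points of differentiability of every Lipschitz function. -/
theorem exists_differentiableAt_of_wedgeApprox [CompleteSpace E] [Nontrivial E] {M : ℝ → Set E}
    (hM : Monotone M) (hMc : ∀ i, IsClosed (M i))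
    (hW : ∀ i j, 0 ≤ i → i < j → j ≤ 1 → ∀ x ∈ M i, WedgeApprox (M j) x) {y : E} (hy : y ∈ M 0)
    {d : ℝ} (hd : 0 < d) {f : E → ℝ} (hf : LipschitzWith (1 / 2) f) :
    ∃ x ∈ M 1, DifferentiableAt ℝ f x ∧ ‖x - y‖ ≤ d := by
  have hf1 : LipschitzWith 1 f := hf.weaken (by
    rw [← NNReal.coe_le_coe]; push_cast; norm_num)
  obtain ⟨P₀, hP₀, hP₀M, hP₀y⟩ := (hW 0 (1 / 2) le_rfl (by norm_num) (by norm_num) y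
    hy).exists_admissible hf1 hd
  obtain ⟨P, v, i, hP, hv, hPy, hi0, hi1, hPM, hmax⟩ := exists_almostMaximal hf1 hM hMc
    (K := 406) (by norm_num) (show (1 / 2 : ℝ) < 1 by norm_num) ⟨P₀, hP₀, hP₀M, hP₀y⟩
  set F : E → ℝ := fun x => f x + ⟪v, x⟫ with hF
  have hFlip : LipschitzWith 1 F := by
    refine LipschitzWith.of_dist_le_mul fun x z => ?_
    have h1 := hf.dist_le_mul x z
    have h2 := abs_real_inner_le_norm v (x - z)
    rw [Real.dist_eq, dist_eq_norm] at h1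
    push_cast at h1
    rw [Real.dist_eq, dist_eq_norm, NNReal.coe_one,
      show F x - F z = (f x - f z) + ⟪v, x - z⟫ by simp only [hF, inner_sub_right]; ring]
    refine (abs_add_le _ _).trans ?_
    nlinarith [norm_nonneg (x - z)]
  have hlin : ∀ (x e : E), HasLineDerivAt ℝ (fun x : E => ⟪v, x⟫) ⟪v, e⟫ x e := fun x e => by
    simpa using ((innerSL ℝ v).hasFDerivAt (x := x)).hasLineDerivAt e
  have hPF : DirPoint.Admissible (⟨P.pt, P.dir, P.val v⟩ : DirPoint E) F :=
    ⟨hP.1, HasDerivAt.add hP.2 (hlin P.pt P.dir)⟩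
  have hdiff := hasFDerivAt_of_almostMaximal hFlip hPF (by
    intro ε hε
    obtain ⟨δ, hδ, j, hij, hj1, hj⟩ := hmax ε hε
    refine ⟨δ, hδ, M j, hW i j (by linarith) hij hj1 _ hPM, fun Q hQ hQM hQP hPQ hinc => ?_⟩
    have hQval : DirPoint.val (⟨Q.pt, Q.dir, Q.slope - ⟪v, Q.dir⟫⟩ : DirPoint E) v = Q.slope := by
      simp [DirPoint.val]
    have h := hj ⟨Q.pt, Q.dir, Q.slope - ⟪v, Q.dir⟫⟩ ⟨hQ.1, ?_⟩ hQM hQP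
      (by rw [hQval]; exact hPQ) ?_
    · rw [hQval] at h
      exact h
    · have h1 := HasDerivAt.sub hQ.2 (hlin Q.pt Q.dir)
      refine HasDerivAt.congr_of_eventuallyEq h1 (Eventually.of_forall fun t => ?_)
      simp [hF]
    · intro t
      rw [hQval]
      refine le_trans (le_of_eq ?_) (hinc t)
      congr 1
      simp only [hF, inner_add_right]
      ring)
  refine ⟨P.pt, hM hi1.le hPM, ?_, hPy⟩
  have h1 : DifferentiableAt ℝ (fun x : E => ⟪v, x⟫) P.pt := (innerSL ℝ v).differentiableAt
  have h2 : f = fun x => F x - ⟪v, x⟫ := by ext x; simp [hF]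
  rw [h2]
  exact hdiff.differentiableAt.sub h1

end Final

theorem exists_differentiableAt_spaceSet {N : ℕ → ℕ} (hgt : ∀ r, 1 < N r) {n : ℕ} (hn : 2 ≤ n)
    {k l : ℕ → ℝ} (hk : k ∈ Index N) (hl : l ∈ Index N) (hkl : Prec k l)
    {y : EuclideanSpace ℝ (Fin n)} (hy : y ∈ spaceSet N hn k) {d : ℝ} (hd : 0 < d)
    {g : EuclideanSpace ℝ (Fin n) → ℝ} {L : NNReal} (hg : LipschitzWith L g) :
    ∃ x ∈ spaceSet N hn l, DifferentiableAt ℝ g x ∧ ‖x - y‖ ≤ d := by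
  have hl1 : ∀ r, 1 ≤ l r := fun r => (hl.1 r).1
  have : Nontrivial (EuclideanSpace ℝ (Fin n)) := by
    have : Nonempty (Fin n) := ⟨⟨0, by omega⟩⟩
    infer_instance
  -- rescale so that the Lipschitz constant is at most `1 / 2`
  set κ : ℝ := (2 * (L + 1))⁻¹ with hκ
  have hκ0 : 0 < κ := by positivity
  have hf : LipschitzWith (1 / 2) fun x => κ * g x := by
    refine LipschitzWith.of_dist_le_mul fun x z => ?_
    have h1 := hg.dist_le_mul x z
    rw [Real.dist_eq] at h1 ⊢
    rw [← mul_sub, abs_mul, abs_of_pos hκ0]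
    calc κ * |g x - g z| ≤ κ * (L * dist x z) := by gcongr
      _ = κ * L * dist x z := by ring
      _ ≤ _ := by
        refine mul_le_mul_of_nonneg_right ?_ dist_nonneg
        push_cast
        rw [hκ, inv_mul_le_iff₀ (by positivity)]
        linarith
  obtain ⟨x, hx, hdiff, hxy⟩ := exists_differentiableAt_of_wedgeApprox
    (M := fun t => spaceSet N hn (interp k l t))
    (fun s t hst => spaceSet_mono hgt hn (interp_anti hl1 hkl hst))
    (fun t => isClosed_spaceSet N hn _)
    (fun s t hs hst ht x hx => wedgeApprox_spaceSet hgt hn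
      (interp_mem_index hgt hk hl hkl hs (hst.le.trans ht))
      (interp_mem_index hgt hk hl hkl (hs.trans hst.le) ht) (prec_interp hl1 hkl hst) hx)
    (y := y) (by simpa only [interp_zero hl1] using hy) hd hf
  refine ⟨x, by simpa only [interp_one] using hx, ?_, hxy⟩
  have h1 : g = fun x => κ⁻¹ * (κ * g x) := by
    ext x
    field_simp
  rw [h1]
  exact hdiff.const_mul κ⁻¹

/-- The square root of an index lies between the index and the constant sequence `1`. -/
theorem sqrt_mem_index {N : ℕ → ℕ} {i : ℕ → ℝ} (hi : i ∈ Index N)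
    (hi1 : Prec i fun _ => 1) :
    (fun r => √(i r)) ∈ Index N ∧ Prec i (fun r => √(i r)) ∧
      Prec (fun r => √(i r)) fun _ => 1 := by
  have h1 : ∀ r, 1 < i r := hi1.1
  have htop : Tendsto (fun r => √(i r)) atTop atTop :=
    Real.tendsto_sqrt_atTop.comp (by simpa using hi1.2)
  have hlt : ∀ r, √(i r) < i r := fun r => by
    rw [Real.sqrt_lt' (by linarith [h1 r])]
    nlinarith [h1 r]
  have hgt1 : ∀ r, 1 < √(i r) := fun r => by
    rw [Real.lt_sqrt zero_le_one, one_pow]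
    exact h1 r
  refine ⟨⟨fun r => ⟨(hgt1 r).le, (hlt r).trans (hi.1 r).2⟩, ?_⟩, ⟨hlt, ?_⟩,
    ⟨hgt1, by simpa using htop⟩⟩
  · refine squeeze_zero (fun r => by positivity) (fun r => ?_) hi.2
    exact div_le_div_of_nonneg_right (hlt r).le (Nat.cast_nonneg _)
  · simpa only [Real.div_sqrt] using htop

end NullSet

end

theorem mainTheorem2 (N : ℕ → ℕ) (hodd : ∀ r, Odd (N r)) (hgt : ∀ r, 1 < N r)
    (hlim : Tendsto N atTop atTop)
    (hsum : ¬ Summable (fun r => 1 / (N r : ℝ) ^ 2))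
    (n : ℕ) (hn : 2 ≤ n) :
    (∀ k ∈ NullSet.Index N, ∀ l ∈ NullSet.Index N, NullSet.Prec k l →
      ∀ y ∈ NullSet.spaceSet N hn k, ∀ d : ℝ, 0 < d →
      ∀ g : EuclideanSpace ℝ (Fin n) → ℝ, (∃ L, LipschitzWith L g) →
        ∃ x ∈ NullSet.spaceSet N hn l, DifferentiableAt ℝ g x ∧ ‖x - y‖ ≤ d) ∧
    (∀ g : EuclideanSpace ℝ (Fin n) → ℝ, (∃ L, LipschitzWith L g) →
      NullSet.unionSet N hn ⊆
        closure {x | x ∈ NullSet.unionSet N hn ∧ DifferentiableAt ℝ g x}) := by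
  refine ⟨fun k hk l hl hkl y hy d hd g ⟨L, hg⟩ =>
    NullSet.exists_differentiableAt_spaceSet hgt hn hk hl hkl hy hd hg, fun g ⟨L, hg⟩ y hy => ?_⟩
  obtain ⟨i, ⟨hi, hi1⟩, hyi⟩ := Set.mem_iUnion₂.1 hy
  obtain ⟨hl, hil, hl1⟩ := NullSet.sqrt_mem_index hi hi1
  rw [Metric.mem_closure_iff]
  intro ε hε
  obtain ⟨x, hx, hdiff, hxy⟩ := NullSet.exists_differentiableAt_spaceSet hgt hn hi hl hil hyi
    (half_pos hε) hg
  refine ⟨x, ⟨Set.mem_iUnion₂.2 ⟨_, ⟨hl, hl1⟩, hx⟩, hdiff⟩, ?_⟩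
  rw [dist_comm, dist_eq_norm]
  linarith
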